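/- A geometric graph is a simple graph whose vertex set is a finite set of points in the Euclidean plane, no three of which are collinear, and whose edges are drawn as closed straight-line segments between their endpoints. Two distinct edges cross if they have a point in common that is not a common endpoint; a geometric graph is non-crossing if no two of its edges cross. A non-crossing matching is a non-crossing geometric graph in which every vertex has degree at most one; a non-crossing perfect matching is a non-crossing geometric graph in which every vertex has degree exactly one, and it is even if its number of edges is even. For a non-crossing perfect matching $M$ with vertex set $V(M)$ and edge set $E(M)$, the visibility graph of $V(M)$ (with the edges of $M$ as obstacles) is the graph with vertex set $V(M)$ in which two distinct vertices $v,w$ are adjacent if and only if the segment $vw$ crosses no edge of $M$ (in particular, every edge of $M$ belongs to it). Let $M$ be an even non-crossing perfect matching, and let $G$ be the graph obtained from the visibility graph of $V(M)$ by removing all the edges in $E(M)$. Then $G$ has a perfect matching in the graph-theoretic sense (a set of edges of $G$, possibly crossing one another, such that every vertex of $V(M)$ is incident to exactly one of them), and this perfect matching can be chosen to be the union of two non-crossing matchings. -/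

import Mathlib

namespace GeomGraph

/-- The Euclidean plane. -/
abbrev Plane := EuclideanSpace ℝ (Fin 2)

/-- No three distinct points of `V` are collinear. -/
def GeneralPosition (V : Finset Plane) : Prop :=
  ∀ a ∈ V, ∀ b ∈ V, ∀ c ∈ V, a ≠ b → a ≠ c → b ≠ c →
    ¬ Collinear ℝ ({a, b, c} : Set Plane)

/-- The closed segments `ab` and `cd` share a point that is not a common endpoint. This is what it
means for two *distinct* edges `ab` and `cd` to cross. -/
def Crosses (a b c d : Plane) : Prop :=
  ∃ p ∈ segment ℝ a b ∩ segment ℝ c d, p ∉ ({a, b} ∩ {c, d} : Set Plane)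

/-! A geometric graph with vertex set `V` is a simple graph on the type of points of `V`; its edge
`ab` is drawn as the closed segment from `a` to `b`. -/

/-- Any two distinct edges intersect at most at a common endpoint. -/
def NonCrossing {V : Finset Plane} (G : SimpleGraph V) : Prop :=
  ∀ a b c d : V, G.Adj a b → G.Adj c d → s(a, b) ≠ s(c, d) →
    ¬ Crosses (a : Plane) b c d

/-- A matching: a non-crossing geometric graph in which every vertex has degree at most one. -/
def IsMatching {V : Finset Plane} (G : SimpleGraph V) : Prop :=
  NonCrossing G ∧ ∀ v : V, (G.neighborSet v).Subsingleton

/-- A perfect matching: a non-crossing geometric graph in which every vertex has degree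
exactly one. -/
def IsPerfectMatching {V : Finset Plane} (G : SimpleGraph V) : Prop :=
  NonCrossing G ∧ ∀ v : V, ∃! w : V, G.Adj v w

/-- The visibility graph of the vertex set of `M`, with the edges of `M` as obstacles: distinct
vertices `v`, `w` are adjacent if and only if the segment `vw` crosses no edge of `M`
(where an edge of `M` does not cross itself). -/
def visibilityGraph {V : Finset Plane} (M : SimpleGraph V) : SimpleGraph V where
  Adj v w := v ≠ w ∧ ∀ c d : V, M.Adj c d → s(v, w) ≠ s(c, d) →
    ¬ Crosses (v : Plane) w c d
  symm := ⟨by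
    rintro v w ⟨hne, h⟩
    refine ⟨hne.symm, fun c d hcd hs hx => h c d hcd (by rwa [Sym2.eq_swap]) ?_⟩
    obtain ⟨p, hp, hp'⟩ := hx
    refine ⟨p, by rwa [segment_symm], ?_⟩
    rwa [Set.pair_comm]⟩
  loopless := ⟨fun _ h => h.1 rfl⟩

end GeomGraph

namespace GeomGraph

/-! Fix a linear functional `φ` injective on `V`, so that every edge of `M` has a left and a right
endpoint. It suffices to match the left endpoints among themselves, without crossings, by segments
that cross no edge of `M` (`exists_matching_left`): with `-φ` the same matches the right endpoints,
and the union is perfect. It avoids `M`, whose edges join left to right endpoints.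

Extend every edge to the right until it ends on another slit or at a far level of `φ`
(`exists_slitSystem`); the left endpoints become the tips. From each tip that is not leftmost some
tip further left is visible (`exists_adj_lt`), so visibility among tips is connected. There are as
many tips as edges of `M`, an even number, so some mod 2 edge chain has odd degree at every tip.
Take a shortest one.

Minimality makes it a non-crossing matching. By `exists_chain_lt`, a two-leg path over `p` that
avoids the slits, with no slit starting at `p` into the triangle, can be replaced by a strictly
shorter chain. So no two chain edges lie on the same side of the slit at their common tip; a degree
is then at most two, and being odd it is one. Two crossing edges could likewise be exchanged for two
chains around the crossing. The geometric core is `free_of_triangle`: a slit entering a triangle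
without tips through the third side must end inside, hence on another slit that ends further right,
which cannot go on forever. -/

/-! ### Affine functions and barycentric coordinates -/

/-- The earlier of the zeros `f₀ / (f₀ - f₁)` and `h₀ / (h₀ - h₁)` works: up to it both affine
functions stay nonnegative. -/
theorem exists_first_zero {f₀ f₁ h₀ h₁ : ℝ} (hf : 0 < f₀) (hh : 0 < h₀) (h : f₁ < 0 ∨ h₁ < 0) :
    ∃ s, 0 < s ∧ s < 1 ∧ 0 ≤ f₀ + s * (f₁ - f₀) ∧ 0 ≤ h₀ + s * (h₁ - h₀) ∧
      (f₀ + s * (f₁ - f₀) = 0 ∨ h₀ + s * (h₁ - h₀) = 0) := by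
  have key : ∀ {f₀ f₁ h₀ h₁ : ℝ}, 0 < f₀ → 0 < h₀ → f₁ < 0 →
      (h₁ < 0 → f₀ / (f₀ - f₁) ≤ h₀ / (h₀ - h₁)) →
      ∃ s, 0 < s ∧ s < 1 ∧ f₀ + s * (f₁ - f₀) = 0 ∧ 0 ≤ h₀ + s * (h₁ - h₀) := by
    intro f₀ f₁ h₀ h₁ hf hh h1 hle
    have hd : 0 < f₀ - f₁ := by linarith
    have hs0 : 0 < f₀ / (f₀ - f₁) := div_pos hf hd
    have hs1 : f₀ / (f₀ - f₁) < 1 := by rw [div_lt_one hd]; linarith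
    refine ⟨f₀ / (f₀ - f₁), hs0, hs1, by field_simp; ring, ?_⟩
    rcases lt_or_ge h₁ 0 with h2 | h2
    · have hd' : 0 < h₀ - h₁ := by linarith
      have := hle h2
      rw [le_div_iff₀ hd'] at this
      linarith
    · nlinarith
  by_cases h1 : f₁ < 0
  · by_cases h2 : h₁ < 0
    · rcases le_total (f₀ / (f₀ - f₁)) (h₀ / (h₀ - h₁)) with hle | hle
      · obtain ⟨s, a, b, c, d⟩ := key hf hh h1 fun _ => hle
        exact ⟨s, a, b, c.ge, d, Or.inl c⟩
      · obtain ⟨s, a, b, c, d⟩ := key hh hf h2 fun _ => hle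
        exact ⟨s, a, b, d, c.ge, Or.inr c⟩
    · obtain ⟨s, a, b, c, d⟩ := key hf hh h1 fun h => absurd h h2
      exact ⟨s, a, b, c.ge, d, Or.inl c⟩
  · have h2 : h₁ < 0 := h.resolve_left h1
    obtain ⟨s, a, b, c, d⟩ := key hh hf h2 fun h => absurd h h1
    exact ⟨s, a, b, d, c.ge, Or.inr c⟩

/-- Along a line on which `f`, `g`, `h` are affine and positive at `t₀`: if `f` and `h` cannot vanish
before the region `f, g, h ≥ 0` is left and the line does not start in it with `g > 0`, then the line
ends in it with `g > 0`. -/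
theorem affine_end_of_side_avoided {fa fc ga gc ha hc t₀ : ℝ} (ht0 : 0 < t₀) (ht1 : t₀ < 1)
    (hf : 0 < fa + t₀ * (fc - fa)) (hg : 0 < ga + t₀ * (gc - ga)) (hh : 0 < ha + t₀ * (hc - ha))
    (hside : ∀ t, 0 < t → t < 1 → 0 ≤ fa + t * (fc - fa) → 0 ≤ ga + t * (gc - ga) →
      0 ≤ ha + t * (hc - ha) → fa + t * (fc - fa) ≠ 0 ∧ ha + t * (hc - ha) ≠ 0)
    (hleft : ¬ (0 ≤ fa ∧ 0 < ga ∧ 0 ≤ ha)) : 0 ≤ fc ∧ 0 < gc ∧ 0 ≤ hc := by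
  have hga : ga ≤ 0 := by
    by_contra hga
    push Not at hga
    have hneg : fa < 0 ∨ ha < 0 := by
      by_contra hcon
      push Not at hcon
      exact hleft ⟨hcon.1, hga, hcon.2⟩
    obtain ⟨s, hs0, hs1, h1, h2, h3⟩ := exists_first_zero hf hh hneg
    have e1 : fa + t₀ * (fc - fa) + s * (fa - (fa + t₀ * (fc - fa))) =
      fa + (t₀ * (1 - s)) * (fc - fa) := by ring
    have e2 : ha + t₀ * (hc - ha) + s * (ha - (ha + t₀ * (hc - ha))) =
      ha + (t₀ * (1 - s)) * (hc - ha) := by ring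
    have e3 : ga + (t₀ * (1 - s)) * (gc - ga) = s * ga + (1 - s) * (ga + t₀ * (gc - ga)) := by ring
    rw [e1] at h1 h3
    rw [e2] at h2 h3
    have hs2 : 0 < 1 - s := by linarith
    have := hside (t₀ * (1 - s)) (by positivity) (by nlinarith) h1
      (by rw [e3]; positivity) h2
    tauto
  have hgc : 0 < gc := by
    by_contra hcon
    push Not at hcon
    nlinarith
  have hneg : ¬ (fc < 0 ∨ hc < 0) := by
    intro hneg
    obtain ⟨s, hs0, hs1, h1, h2, h3⟩ := exists_first_zero hf hh hneg
    have e1 : fa + t₀ * (fc - fa) + s * (fc - (fa + t₀ * (fc - fa))) =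
      fa + (t₀ + s * (1 - t₀)) * (fc - fa) := by ring
    have e2 : ha + t₀ * (hc - ha) + s * (hc - (ha + t₀ * (hc - ha))) =
      ha + (t₀ + s * (1 - t₀)) * (hc - ha) := by ring
    have e3 : ga + (t₀ + s * (1 - t₀)) * (gc - ga) =
      s * gc + (1 - s) * (ga + t₀ * (gc - ga)) := by ring
    rw [e1] at h1 h3
    rw [e2] at h2 h3
    have hs2 : 0 < 1 - s := by linarith
    have ht2 : 0 < 1 - t₀ := by linarith
    have := hside (t₀ + s * (1 - t₀)) (by positivity) (by nlinarith) h1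
      (by rw [e3]; positivity) h2
    tauto
  push Not at hneg
  exact ⟨hneg.1, hgc, hneg.2⟩

theorem mem_openSegment_of_mem_openSegment {x y z w q : Plane} (hz : z ∈ openSegment ℝ x y)
    (hw : w ∈ segment ℝ x y) (hq : q ∈ openSegment ℝ z w) : q ∈ openSegment ℝ x y := by
  obtain ⟨a, b, ha, hb, hab, rfl⟩ := hz
  obtain ⟨c, d, hc, hd, hcd, rfl⟩ := hw
  obtain ⟨r, s, hr, hs, hrs, rfl⟩ := hq
  refine ⟨r * a + s * c, r * b + s * d, by positivity, by positivity, ?_, by module⟩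
  calc r * a + s * c + (r * b + s * d) = r * (a + b) + s * (c + d) := by ring
    _ = 1 := by rw [hab, hcd]; linarith

/-- The closed triangle with vertices `u`, `p`, `w`. -/
def triangle (u p w : Plane) : Set Plane :=
  {x | ∃ r s t : ℝ, 0 ≤ r ∧ 0 ≤ s ∧ 0 ≤ t ∧ r + s + t = 1 ∧ x = r • u + s • p + t • w}

/-- The coordinate form of general position; it reduces later incidence claims to polynomial
identities. -/
theorem not_collinear_iff_det {u p w : Plane} :
    ¬ Collinear ℝ {u, p, w} ↔
      (p 0 - u 0) * (w 1 - u 1) - (p 1 - u 1) * (w 0 - u 0) ≠ 0 := by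
  rw [not_iff_not, collinear_iff_of_mem (p₀ := u) (by simp)]
  constructor
  · rintro ⟨v, hv⟩
    obtain ⟨r, hr⟩ := hv p (by simp)
    obtain ⟨s, hs⟩ := hv w (by simp)
    rw [hr, hs]
    simp
    ring
  · intro h
    by_cases hp : p = u
    · refine ⟨w - u, ?_⟩
      simp only [Set.mem_insert_iff, Set.mem_singleton_iff, forall_eq_or_imp, forall_eq]
      exact ⟨⟨0, by simp⟩, ⟨0, by simp [hp]⟩, ⟨1, by simp⟩⟩
    · refine ⟨p - u, ?_⟩
      simp only [Set.mem_insert_iff, Set.mem_singleton_iff, forall_eq_or_imp, forall_eq]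
      refine ⟨⟨0, by simp⟩, ⟨1, by simp⟩, ?_⟩
      by_cases h0 : p 0 - u 0 = 0
      · have h1 : p 1 - u 1 ≠ 0 := by
          intro h1
          apply hp
          ext i
          fin_cases i
          · simpa using sub_eq_zero.1 h0
          · simpa using sub_eq_zero.1 h1
        refine ⟨(w 1 - u 1) / (p 1 - u 1), ?_⟩
        have h2 : w 0 - u 0 = 0 := by
          rw [h0] at h
          simpa [h1] using h
        ext i
        fin_cases i
        · simp [h0]; linarith
        · simp; field_simp; ring
      · refine ⟨(w 0 - u 0) / (p 0 - u 0), ?_⟩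
        ext i
        fin_cases i
        · simp; field_simp; ring
        · simp; field_simp; linarith

/-- Barycentric coordinates with respect to a non-degenerate triangle. -/
theorem exists_barycentric {u p w : Plane} (h : ¬ Collinear ℝ {u, p, w}) :
    ∃ f g k : Plane → ℝ,
      (∀ x y t, f (AffineMap.lineMap x y t) = f x + t * (f y - f x)) ∧
      (∀ x y t, g (AffineMap.lineMap x y t) = g x + t * (g y - g x)) ∧
      (∀ x y t, k (AffineMap.lineMap x y t) = k x + t * (k y - k x)) ∧
      (∀ x, f x + g x + k x = 1) ∧ (∀ x, x = f x • u + g x • p + k x • w) ∧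
      (∀ r s t : ℝ, r + s + t = 1 → f (r • u + s • p + t • w) = r ∧
        g (r • u + s • p + t • w) = s ∧ k (r • u + s • p + t • w) = t) := by
  rw [not_collinear_iff_det] at h
  set D := (p 0 - u 0) * (w 1 - u 1) - (p 1 - u 1) * (w 0 - u 0) with hD
  have hg : ∀ x : Plane, ∀ r s t : ℝ, r + s + t = 1 → x = r • u + s • p + t • w →
      ((x 0 - u 0) * (w 1 - u 1) - (x 1 - u 1) * (w 0 - u 0)) / D = s ∧
      ((p 0 - u 0) * (x 1 - u 1) - (p 1 - u 1) * (x 0 - u 0)) / D = t := by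
    rintro x r s t h1 rfl
    obtain rfl : r = 1 - s - t := by linarith
    constructor
    · rw [div_eq_iff h, hD]; simp; ring
    · rw [div_eq_iff h, hD]; simp; ring
  refine ⟨fun x => 1 - ((x 0 - u 0) * (w 1 - u 1) - (x 1 - u 1) * (w 0 - u 0)) / D -
      ((p 0 - u 0) * (x 1 - u 1) - (p 1 - u 1) * (x 0 - u 0)) / D,
    fun x => ((x 0 - u 0) * (w 1 - u 1) - (x 1 - u 1) * (w 0 - u 0)) / D,
    fun x => ((p 0 - u 0) * (x 1 - u 1) - (p 1 - u 1) * (x 0 - u 0)) / D,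
    ?_, ?_, ?_, ?_, ?_, ?_⟩
  · intro x y t
    simp [AffineMap.lineMap_apply]; field_simp; ring
  · intro x y t
    simp [AffineMap.lineMap_apply]; field_simp; ring
  · intro x y t
    simp [AffineMap.lineMap_apply]; field_simp; ring
  · intro x; ring
  · intro x
    ext i
    fin_cases i
    · simp; field_simp; rw [hD]; ring
    · simp; field_simp; rw [hD]; ring
  · intro r s t hrst
    obtain ⟨h1, h2⟩ := hg _ r s t hrst rfl
    refine ⟨?_, h1, h2⟩
    beta_reduce
    rw [h1, h2]; linarith

/-! ### Slit systems and free triangles -/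

/-- Slits `(tip i, finish i)` in the plane, going from left to right with respect to `φ`, such that each
slit ends on another one or far to the right. -/
structure SlitSystem (ι : Type*) where
  tip : ι → Plane
  finish : ι → Plane
  φ : Plane →ₗ[ℝ] ℝ
  bound : ℝ
  lt_finish : ∀ i, φ (tip i) < φ (finish i)
  lt_bound : ∀ i, φ (tip i) < bound
  tips : ∀ i j k, i ≠ j → i ≠ k → j ≠ k → ¬ Collinear ℝ {tip i, tip j, tip k}
  tip_off : ∀ i k, i ≠ k → ¬ Collinear ℝ {tip i, tip k, finish k}
  disj : ∀ i k, i ≠ k →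
    Disjoint (openSegment ℝ (tip i) (finish i)) (openSegment ℝ (tip k) (finish k))
  finishes : ∀ i, bound ≤ φ (finish i) ∨ ∃ k, finish i ∈ openSegment ℝ (tip k) (finish k)

namespace SlitSystem

variable {ι : Type*} (S : SlitSystem ι)

/-- The `i`-th slit. -/
def slit (i : ι) : Set Plane := openSegment ℝ (S.tip i) (S.finish i)

/-- The segment `xy` meets no slit. -/
def Free (x y : Plane) : Prop := ∀ k, Disjoint (segment ℝ x y) (S.slit k)

theorem Free.symm {S : SlitSystem ι} {x y : Plane} (h : S.Free x y) : S.Free y x := by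
  intro k
  rw [segment_symm]
  exact h k

theorem Free.mono {S : SlitSystem ι} {x y x' y' : Plane} (h : S.Free x y)
    (hx : x' ∈ segment ℝ x y) (hy : y' ∈ segment ℝ x y) : S.Free x' y' :=
  fun k => (h k).mono_left ((convex_segment x y).segment_subset hx hy)

theorem slit_eq (i : ι) :
    S.slit i = AffineMap.lineMap (S.tip i) (S.finish i) '' Set.Ioo (0 : ℝ) 1 :=
  openSegment_eq_image_lineMap ..

theorem tip_injective : Function.Injective S.tip := by
  intro i k h
  by_contra hne
  exact S.tip_off i k hne (by rw [h]; simpa using collinear_pair ℝ (S.tip k) (S.finish k))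

theorem φ_lt_of_mem_slit {i : ι} {x : Plane} (h : x ∈ S.slit i) : S.φ x < S.φ (S.finish i) := by
  rw [slit_eq] at h
  obtain ⟨t, ⟨h0, h1⟩, rfl⟩ := h
  have := S.lt_finish i
  simp only [AffineMap.lineMap_apply, vsub_eq_sub, vadd_eq_add, map_add, map_smul, map_sub,
    smul_eq_mul]
  nlinarith

theorem φ_lt_bound_of_mem_triangle {u p w : Plane} (hu : S.φ u < S.bound) (hp : S.φ p < S.bound)
    (hw : S.φ w < S.bound) {x : Plane} (hx : x ∈ triangle u p w) : S.φ x < S.bound := by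
  obtain ⟨r, s, t, hr, hs, ht, h1, rfl⟩ := hx
  simp only [map_add, map_smul, smul_eq_mul]
  have key : 0 < r * (S.bound - S.φ u) + s * (S.bound - S.φ p) + t * (S.bound - S.φ w) := by
    have hu' := sub_pos.2 hu
    have hp' := sub_pos.2 hp
    have hw' := sub_pos.2 hw
    rcases hr.lt_or_eq with hr' | hr'
    · positivity
    rcases hs.lt_or_eq with hs' | hs'
    · positivity
    have : 0 < t := by linarith
    positivity
  have : S.bound = r * S.bound + s * S.bound + t * S.bound := by rw [← add_mul, ← add_mul, h1, one_mul]
  linarith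

/-- If two sides of a triangle are free and no slit starts in the triangle away from the third side,
then the third side is free. -/
theorem free_of_triangle [Finite ι] {u p w : Plane} (hnc : ¬ Collinear ℝ {u, p, w}) {i m : ι}
    (him : i ≠ m) (hu : u = S.tip i) (hm : S.tip m ∈ segment ℝ u w)
    (hup : S.Free u p) (hpw : S.Free p w)
    (hL : ∀ k, S.tip k ∈ triangle u p w → S.tip k = p ∨ S.tip k ∈ segment ℝ u w)
    (hp : ∀ k, S.tip k = p → Disjoint (triangle u p w) (S.slit k))
    (hbp : S.φ p < S.bound) (hbw : S.φ w < S.bound) : S.Free u w := by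
  obtain ⟨f, g, h, lf, lg, lh, sum1, rep, uniq⟩ := exists_barycentric hnc
  have mem_tri : ∀ x, x ∈ triangle u p w ↔ 0 ≤ f x ∧ 0 ≤ g x ∧ 0 ≤ h x := by
    intro x
    constructor
    · rintro ⟨r, s, t, hr, hs, ht, h1, rfl⟩
      obtain ⟨e1, e2, e3⟩ := uniq r s t h1
      rw [e1, e2, e3]
      exact ⟨hr, hs, ht⟩
    · rintro ⟨h1, h2, h3⟩
      exact ⟨f x, g x, h x, h1, h2, h3, sum1 x, rep x⟩
  have g_seg : ∀ x, x ∈ segment ℝ u w → g x = 0 := by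
    rintro x ⟨a, b, ha, hb, hab, rfl⟩
    have := (uniq a 0 b (by linarith)).2.1
    simpa using this
  have mem_pw : ∀ x, 0 ≤ g x → 0 ≤ h x → f x = 0 → x ∈ segment ℝ p w := by
    intro x hg hh hf
    refine ⟨g x, h x, hg, hh, by linarith [sum1 x], ?_⟩
    conv_rhs => rw [rep x, hf]
    simp
  have mem_up : ∀ x, 0 ≤ f x → 0 ≤ g x → h x = 0 → x ∈ segment ℝ u p := by
    intro x hf hg hh
    refine ⟨f x, g x, hf, hg, by linarith [sum1 x], ?_⟩
    conv_rhs => rw [rep x, hh]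
    simp
  have side : ∀ j x, x ∈ S.slit j → 0 ≤ f x → 0 ≤ g x → 0 ≤ h x → f x ≠ 0 ∧ h x ≠ 0 := by
    intro j x hx h1 h2 h3
    exact ⟨fun h0 => Set.disjoint_left.1 (hpw j) (mem_pw x h2 h3 h0) hx,
      fun h0 => Set.disjoint_left.1 (hup j) (mem_up x h1 h2 h0) hx⟩
  -- No slit meets the sides `f = 0` and `h = 0`, and this slit does not start in the part `g > 0`
  -- of the triangle. So it came in through `uw` and cannot leave.
  have enter : ∀ j x, x ∈ S.slit j → 0 ≤ f x → 0 < g x → 0 ≤ h x →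
      0 ≤ f (S.finish j) ∧ 0 < g (S.finish j) ∧ 0 ≤ h (S.finish j) := by
    intro j x hx h1 h2 h3
    obtain ⟨n1, n3⟩ := side j x hx h1 h2.le h3
    have hx' := hx
    rw [slit_eq] at hx'
    obtain ⟨t₀, ⟨h0, h1'⟩, rfl⟩ := hx'
    refine affine_end_of_side_avoided (fa := f (S.tip j)) (ga := g (S.tip j))
      (ha := h (S.tip j)) h0 h1' ?_ ?_ ?_ ?_ ?_
    · rw [← lf]; exact lt_of_le_of_ne h1 n1.symm
    · rw [← lg]; exact h2
    · rw [← lh]; exact lt_of_le_of_ne h3 n3.symm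
    · intro t ht0 ht1
      rw [← lf, ← lg, ← lh]
      refine side j _ ?_
      rw [slit_eq]
      exact ⟨t, ⟨ht0, ht1⟩, rfl⟩
    · rintro ⟨a1, a2, a3⟩
      rcases hL j ((mem_tri _).2 ⟨a1, a2.le, a3⟩) with hc | hc
      · exact Set.disjoint_left.1 (hp j hc) ((mem_tri _).2 ⟨h1, h2.le, h3⟩) hx
      · rw [g_seg _ hc] at a2
        exact lt_irrefl _ a2
  have none : ∀ j x, x ∈ S.slit j → 0 ≤ f x → 0 < g x → 0 ≤ h x → False := by
    intro j₀ x₀ hx₀ a₀ b₀ c₀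
    -- Take the entering slit with the rightmost end. That end lies in the triangle, hence below
    -- `bound`, hence on another slit, which also enters but ends further right.
    obtain ⟨j, hj, hmax⟩ := Set.exists_max_image
      {j | ∃ x, x ∈ S.slit j ∧ 0 ≤ f x ∧ 0 < g x ∧ 0 ≤ h x} (fun j => S.φ (S.finish j))
      (Set.toFinite _) ⟨j₀, x₀, hx₀, a₀, b₀, c₀⟩
    obtain ⟨x, hx, a, b, c⟩ := hj
    obtain ⟨a', b', c'⟩ := enter j x hx a b c
    rcases S.finishes j with hs | ⟨k, hk⟩
    · have := S.φ_lt_bound_of_mem_triangle (by rw [hu]; exact S.lt_bound i) hbp hbw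
        ((mem_tri _).2 ⟨a', b'.le, c'⟩)
      linarith
    · have h1 := hmax k ⟨_, hk, a', b', c'⟩
      have h2 := S.φ_lt_of_mem_slit (i := k) hk
      exact absurd h1 (not_le.2 h2)
  intro k
  rw [Set.disjoint_left]
  rintro q hq hk
  obtain ⟨fq, hq1⟩ : 0 < f q ∧ 0 < h q := by
    obtain ⟨a, b, ha, hb, hab, rfl⟩ := hq
    obtain ⟨e1, e2, e3⟩ := uniq a 0 b (by linarith)
    simp only [zero_smul, add_zero] at e1 e2 e3
    obtain ⟨n1, n3⟩ := side k _ hk (by rw [e1]; exact ha) e2.ge (by rw [e3]; exact hb)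
    rw [e1] at n1 ⊢
    rw [e3] at n3 ⊢
    exact ⟨lt_of_le_of_ne ha n1.symm, lt_of_le_of_ne hb n3.symm⟩
  have hgq : g q = 0 := g_seg q hq
  -- The line `uw` carries the tips of `i` and `m`; at least one is not the tip of slit `k`, so
  -- `tip_off` forbids slit `k` to lie along this line.
  have coll : ¬ (g (S.tip k) = 0 ∧ g (S.finish k) = 0) := by
    rintro ⟨h1, h2⟩
    have onl : ∀ x, g x = 0 → ∃ r : ℝ, x = r • (w - u) +ᵥ u := by
      intro x hx
      refine ⟨h x, ?_⟩
      have hf : f x = 1 - h x := by linarith [sum1 x]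
      conv_lhs => rw [rep x, hx, hf]
      rw [vadd_eq_add]
      module
    have hc : ∀ l, l ≠ k → g (S.tip l) = 0 → False := by
      intro l hl h3
      refine S.tip_off l k hl ?_
      rw [collinear_iff_exists_forall_eq_smul_vadd]
      refine ⟨u, w - u, ?_⟩
      simp only [Set.mem_insert_iff, Set.mem_singleton_iff, forall_eq_or_imp, forall_eq]
      exact ⟨onl _ h3, onl _ h1, onl _ h2⟩
    by_cases hki : m = k
    · exact hc i (by rw [← hki]; exact him) (g_seg _ (by rw [← hu]; exact left_mem_segment ..))
    · exact hc m hki (g_seg _ hm)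
  have hk' := hk
  rw [slit_eq] at hk'
  obtain ⟨t, ⟨ht0, ht1⟩, rfl⟩ := hk'
  -- Moving from `q` along the slit towards an end with `g > 0`, at most until `f` or `h` vanishes,
  -- reaches a point excluded by `none`.
  have push : ∀ y, y = S.tip k ∨ y = S.finish k → 0 < g y → False := by
    intro y hy hgy
    set q := AffineMap.lineMap (S.tip k) (S.finish k) t
    obtain ⟨s, hs0, hs1, hs2, hs3⟩ : ∃ s : ℝ, 0 < s ∧ s < 1 ∧ 0 ≤ f q + s * (f y - f q) ∧
        0 ≤ h q + s * (h y - h q) := by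
      by_cases hneg : f y < 0 ∨ h y < 0
      · obtain ⟨s, a, b, c, d, -⟩ := exists_first_zero fq hq1 hneg
        exact ⟨s, a, b, c, d⟩
      · push Not at hneg
        exact ⟨1 / 2, by norm_num, by norm_num, by linarith, by linarith⟩
    refine none k (AffineMap.lineMap q y s) ?_ (by rw [lf]; exact hs2) ?_ (by rw [lh]; exact hs3)
    · have : AffineMap.lineMap q y s ∈ openSegment ℝ q y := by
        rw [openSegment_eq_image_lineMap]
        exact ⟨s, ⟨hs0, hs1⟩, rfl⟩
      rcases hy with rfl | rfl
      · exact mem_openSegment_of_mem_openSegment hk (left_mem_segment ..) this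
      · exact mem_openSegment_of_mem_openSegment hk (right_mem_segment ..) this
    · rw [lg, hgq]
      have := mul_pos hs0 hgy
      linarith
  have e := lg (S.tip k) (S.finish k) t
  rw [hgq] at e
  rcases lt_trichotomy (g (S.tip k)) 0 with h1 | h1 | h1
  · refine push _ (Or.inr rfl) ?_
    nlinarith
  · refine coll ⟨h1, ?_⟩
    rw [h1] at e
    have : t * g (S.finish k) = 0 := by linarith
    exact (mul_eq_zero.1 this).resolve_left ht0.ne'
  · exact push _ (Or.inl rfl) h1

end SlitSystem

/-! ### Mod 2 edge chains and their lengths -/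

open Classical in
/-- The boundary of a mod 2 edge chain. -/
noncomputable def boundary {ι : Type*} [Fintype ι] (F : Sym2 ι → ZMod 2) (v : ι) : ZMod 2 :=
  ∑ e, if v ∈ e then F e else 0

open Classical in
/-- The total length of a mod 2 edge chain. -/
noncomputable def chainLength {ι : Type*} [Fintype ι] (len : Sym2 ι → ℝ) (F : Sym2 ι → ZMod 2) : ℝ :=
  ∑ e, if F e = 0 then 0 else len e

/-- There is a mod 2 chain of edges of `H` of length at most `r` with boundary `i + j`. -/
def HasChain {ι : Type*} [Fintype ι] [DecidableEq ι] (H : SimpleGraph ι) (len : Sym2 ι → ℝ)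
    (i j : ι) (r : ℝ) : Prop :=
  ∃ F : Sym2 ι → ZMod 2, (∀ e, F e ≠ 0 → e ∈ H.edgeSet) ∧
    boundary F = Pi.single i 1 + Pi.single j 1 ∧ chainLength len F ≤ r

section

variable {ι : Type*} {H : SimpleGraph ι} {len : Sym2 ι → ℝ}

theorem support_add {F G : Sym2 ι → ZMod 2} (hF : ∀ e, F e ≠ 0 → e ∈ H.edgeSet)
    (hG : ∀ e, G e ≠ 0 → e ∈ H.edgeSet) : ∀ e, (F + G) e ≠ 0 → e ∈ H.edgeSet := by
  intro e he
  by_cases h : F e = 0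
  · exact hG e fun h' => he (by simp [h, h'])
  · exact hF e h

variable [Fintype ι]

theorem chainLength_add_le (hlen : ∀ e, 0 ≤ len e) (F G : Sym2 ι → ZMod 2) :
    chainLength len (F + G) ≤ chainLength len F + chainLength len G := by
  simp only [chainLength, ← Finset.sum_add_distrib]
  refine Finset.sum_le_sum fun e _ => ?_
  have := hlen e
  rw [Pi.add_apply]
  by_cases h1 : F e = 0 <;> by_cases h2 : G e = 0 <;> simp only [h1, h2] <;> split_ifs <;> simp_all

theorem boundary_add (F G : Sym2 ι → ZMod 2) : boundary (F + G) = boundary F + boundary G := by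
  funext v
  simp only [boundary, Pi.add_apply, ← Finset.sum_add_distrib]
  refine Finset.sum_congr rfl fun e _ => ?_
  split_ifs <;> simp

theorem boundary_zero : boundary (0 : Sym2 ι → ZMod 2) = 0 := by
  funext v
  simp [boundary]

theorem boundary_sum {κ : Type*} (s : Finset κ) (F : κ → Sym2 ι → ZMod 2) :
    boundary (∑ k ∈ s, F k) = ∑ k ∈ s, boundary (F k) := by
  classical
  induction s using Finset.induction_on with
  | empty => simp [boundary_zero]
  | insert k s hk ih => rw [Finset.sum_insert hk, Finset.sum_insert hk, boundary_add, ih]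

variable [DecidableEq ι]

theorem boundary_single {i j : ι} (h : i ≠ j) :
    boundary (Pi.single s(i, j) 1 : Sym2 ι → ZMod 2) = Pi.single i 1 + Pi.single j 1 := by
  funext v
  rw [boundary, Finset.sum_eq_single s(i, j)]
  · simp only [Sym2.mem_iff, Pi.single_eq_same, Pi.add_apply, Pi.single_apply]
    by_cases h1 : v = i
    · have : v ≠ j := fun h2 => h (h1 ▸ h2)
      simp [h1, h]
    · simp [h1]
  · intro e _ he
    simp [Pi.single_eq_of_ne he]
  · simp

theorem chainLength_single (e : Sym2 ι) :
    chainLength len (Pi.single e 1 : Sym2 ι → ZMod 2) = len e := by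
  rw [chainLength, Finset.sum_eq_single e]
  · simp
  · intro f _ hf
    simp [Pi.single_eq_of_ne hf]
  · simp

theorem chainLength_add_single {F : Sym2 ι → ZMod 2} {e : Sym2 ι} (he : F e ≠ 0) :
    chainLength len (F + Pi.single e 1) = chainLength len F - len e := by
  have h1 : F e = 1 := by
    generalize F e = x at he
    revert he; revert x; decide
  rw [eq_sub_iff_add_eq, ← chainLength_single (len := len) e, chainLength, chainLength, chainLength,
    ← Finset.sum_add_distrib]
  refine Finset.sum_congr rfl fun f _ => ?_
  by_cases hf : f = e
  · subst hf
    have : (1 : ZMod 2) + 1 = 0 := by decide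
    simp [h1, this]
  · simp [Pi.single_eq_of_ne hf]

theorem HasChain.of_adj {i j : ι} (h : H.Adj i j) : HasChain H len i j (len s(i, j)) := by
  refine ⟨Pi.single s(i, j) 1, ?_, boundary_single h.ne, (chainLength_single _).le⟩
  intro e he
  by_cases h' : e = s(i, j)
  · rw [h']; exact h
  · exact absurd (Pi.single_eq_of_ne h' 1) he

theorem HasChain.refl (i : ι) : HasChain H len i i 0 := by
  refine ⟨0, by simp, ?_, by simp [chainLength]⟩
  rw [boundary_zero]
  funext v
  have : ∀ x : ZMod 2, 0 = x + x := by decide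
  exact this _

theorem HasChain.trans (hlen : ∀ e, 0 ≤ len e) {i j k : ι} {r s : ℝ} (h₁ : HasChain H len i j r)
    (h₂ : HasChain H len j k s) : HasChain H len i k (r + s) := by
  obtain ⟨F, hF, hF', hF''⟩ := h₁
  obtain ⟨G, hG, hG', hG''⟩ := h₂
  refine ⟨F + G, support_add hF hG, ?_, (chainLength_add_le hlen F G).trans (add_le_add hF'' hG'')⟩
  rw [boundary_add, hF', hG']
  funext v
  simp only [Pi.add_apply]
  generalize (Pi.single i 1 : ι → ZMod 2) v = x
  generalize (Pi.single j 1 : ι → ZMod 2) v = y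
  generalize (Pi.single k 1 : ι → ZMod 2) v = z
  revert x y z
  decide

/-- If all vertices are joined to `r` by chains and their number is even, there is a shortest chain
with odd degree at every vertex. -/
theorem exists_shortest_chain (hcard : Even (Fintype.card ι)) (r : ι)
    (hconn : ∀ i, ∃ c, HasChain H len i r c) :
    ∃ F : Sym2 ι → ZMod 2, (∀ e, F e ≠ 0 → e ∈ H.edgeSet) ∧ boundary F = 1 ∧
      ∀ G : Sym2 ι → ZMod 2, (∀ e, G e ≠ 0 → e ∈ H.edgeSet) → boundary G = 1 →
        chainLength len F ≤ chainLength len G := by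
  choose c P hP hP' _ using hconn
  have hne : ({F : Sym2 ι → ZMod 2 | (∀ e, F e ≠ 0 → e ∈ H.edgeSet) ∧ boundary F = 1}).Nonempty := by
    -- Summing the chains to `r` over all `i` counts every vertex once, and `r` additionally an even
    -- number of times.
    refine ⟨∑ i, P i, ?_, ?_⟩
    · intro e he
      rw [Finset.sum_apply] at he
      obtain ⟨i, -, hi⟩ := Finset.exists_ne_zero_of_sum_ne_zero he
      exact hP i e hi
    · rw [boundary_sum]
      simp only [hP', Finset.sum_add_distrib, Finset.sum_const, Finset.card_univ]
      have h0 : (Fintype.card ι) • (Pi.single r 1 : ι → ZMod 2) = 0 := by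
        rw [nsmul_eq_mul]
        have : ((Fintype.card ι : ℕ) : ι → ZMod 2) = 0 := by
          funext v
          simpa using (ZMod.natCast_eq_zero_iff_even).2 hcard
        rw [this, zero_mul]
      rw [h0, add_zero]
      exact Finset.univ_sum_single (1 : ι → ZMod 2)
  obtain ⟨F, hF, hmin⟩ := Set.exists_min_image _ (chainLength len) (Set.toFinite _) hne
  exact ⟨F, hF.1, hF.2, fun G h1 h2 => hmin G ⟨h1, h2⟩⟩

/-- Two edges of a shortest chain cannot be exchanged for a shorter chain with the same boundary. -/
theorem exchange_le (hlen : ∀ e, 0 ≤ len e) {F : Sym2 ι → ZMod 2}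
    (hF : ∀ e, F e ≠ 0 → e ∈ H.edgeSet) (hb : boundary F = 1)
    (hmin : ∀ G : Sym2 ι → ZMod 2, (∀ e, G e ≠ 0 → e ∈ H.edgeSet) → boundary G = 1 →
        chainLength len F ≤ chainLength len G)
    {e₁ e₂ : Sym2 ι} (hne : e₁ ≠ e₂) (h₁ : F e₁ ≠ 0) (h₂ : F e₂ ≠ 0) {E : Sym2 ι → ZMod 2}
    (hE : ∀ e, E e ≠ 0 → e ∈ H.edgeSet)
    (hEb : boundary E = boundary (Pi.single e₁ 1) + boundary (Pi.single e₂ 1)) :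
    len e₁ + len e₂ ≤ chainLength len E := by
  have hs : ∀ e₀ : Sym2 ι, F e₀ ≠ 0 → ∀ e, (Pi.single e₀ 1 : Sym2 ι → ZMod 2) e ≠ 0 →
      e ∈ H.edgeSet := by
    intro e₀ h0 e he
    by_cases h' : e = e₀
    · rw [h']; exact hF _ h0
    · exact absurd (Pi.single_eq_of_ne h' 1) he
  -- Mod 2, adding an edge of `F` deletes it; `E` then repairs the boundary.
  have h := hmin (F + Pi.single e₁ 1 + Pi.single e₂ 1 + E)
    (support_add (support_add (support_add hF (hs _ h₁)) (hs _ h₂)) hE) (by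
      rw [boundary_add, boundary_add, boundary_add, hEb, hb]
      funext v
      simp only [Pi.add_apply]
      generalize boundary (Pi.single e₁ 1 : Sym2 ι → ZMod 2) v = x
      generalize boundary (Pi.single e₂ 1 : Sym2 ι → ZMod 2) v = y
      rw [Pi.one_apply]
      revert x y
      decide)
  have h' := chainLength_add_le hlen (F + Pi.single e₁ 1 + Pi.single e₂ 1) E
  rw [chainLength_add_single (by
    rw [Pi.add_apply, Pi.single_eq_of_ne hne.symm, add_zero]; exact h₂),
    chainLength_add_single h₁] at h'
  linarith

end

/-! ### Shortcuts for paths with one bend -/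

theorem collinear_of_mem_segment {u w x y : Plane} (hx : x ∈ segment ℝ u w)
    (hy : y ∈ segment ℝ u w) : Collinear ℝ {u, x, y} := by
  by_contra h
  rw [not_collinear_iff_det] at h
  obtain ⟨a, b, -, -, hab, rfl⟩ := hx
  obtain ⟨c, d, -, -, hcd, rfl⟩ := hy
  obtain rfl : a = 1 - b := by linarith
  obtain rfl : c = 1 - d := by linarith
  apply h
  simp
  ring

theorem dist_lt_of_not_collinear {u p v : Plane} (h : ¬ Collinear ℝ {u, p, v}) :
    dist u v < dist u p + dist p v := by
  refine lt_of_le_of_ne (dist_triangle _ _ _) fun he => h ?_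
  exact (dist_add_dist_eq_iff.1 he.symm).collinear

theorem triangle_subset {u p v : Plane} {α f : ℝ} (hα0 : 0 ≤ α) (hα1 : α ≤ 1) (hf0 : 0 ≤ f)
    (hf1 : f ≤ 1) {w x : Plane} (hw : w = α • p + (1 - α) • v) (hx : x = f • u + (1 - f) • w) :
    triangle x w v ⊆ triangle u p v := by
  rintro y ⟨r, s, t, hr, hs, ht, h1, rfl⟩
  have hα1' := sub_nonneg.2 hα1
  have hf1' := sub_nonneg.2 hf1
  refine ⟨r * f, (r * (1 - f) + s) * α, (r * (1 - f) + s) * (1 - α) + t, by positivity,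
    by positivity, by positivity, by linear_combination h1, ?_⟩
  rw [hx, hw]
  module

namespace SlitSystem

variable {ι : Type*} (S : SlitSystem ι)

/-- The graph of pairs of tips whose connecting segment meets no slit. -/
def visGraph : SimpleGraph ι where
  Adj i j := i ≠ j ∧ S.Free (S.tip i) (S.tip j)
  symm := ⟨fun _ _ h => ⟨h.1.symm, h.2.symm⟩⟩
  loopless := ⟨fun _ h => h.1 rfl⟩

/-- The distance of the tips as a function on pairs. -/
noncomputable def tipDist : Sym2 ι → ℝ :=
  Sym2.lift ⟨fun i j => dist (S.tip i) (S.tip j), fun _ _ => dist_comm _ _⟩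

theorem tipDist_nonneg (e : Sym2 ι) : 0 ≤ S.tipDist e := by
  induction e with
  | _ i j => exact (dist_nonneg : 0 ≤ dist (S.tip i) (S.tip j))

/-- Pull the path taut. If the triangle contains no further tip, its third side is free. Otherwise
turn a ray at `tip i` away from `p` until it first meets a tip `k`, and let it reach the opposite
side at `w`. Then `k` is visible from `i`, and the triangle of `tip k`, `w`, `tip j` contains fewer
tips. The bend `p` may be a tip or, as for `w` and for crossings, a bare point. -/
theorem exists_chain_lt [Fintype ι] [DecidableEq ι] {i j : ι} {p : Plane} (hij : i ≠ j)
    (hnc : ¬ Collinear ℝ {S.tip i, p, S.tip j})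
    (hip : S.Free (S.tip i) p) (hpj : S.Free p (S.tip j))
    (hi : ∀ m, S.tip m ∈ segment ℝ (S.tip i) p → m = i ∨ S.tip m = p)
    (hj : ∀ m, S.tip m ∈ segment ℝ p (S.tip j) → S.tip m = p ∨ m = j)
    (hp : ∀ m, S.tip m = p → Disjoint (triangle (S.tip i) p (S.tip j)) (S.slit m))
    (hb : S.φ p < S.bound) :
    ∃ r < dist (S.tip i) p + dist p (S.tip j), HasChain S.visGraph S.tipDist i j r := by
  induction hn : Set.ncard {m | S.tip m ∈ triangle (S.tip i) p (S.tip j)}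
    using Nat.strong_induction_on generalizing i p with
  | _ n ih =>
  set u := S.tip i with hu
  set v := S.tip j with hv
  obtain ⟨f, g, h, -, -, -, sum1, rep, uniq⟩ := exists_barycentric hnc
  have fu : f u = 1 := by simpa using (uniq 1 0 0 (by norm_num)).1
  have hv1 : h v = 1 := by simpa using (uniq 0 0 1 (by norm_num)).2.2
  have gp : g p = 1 := by simpa using (uniq 0 1 0 (by norm_num)).2.1
  by_cases hK : ∀ m, S.tip m ∈ triangle u p v → m ≠ i → m ≠ j → S.tip m = p
  · have hadj : S.visGraph.Adj i j := by
      refine ⟨hij, S.free_of_triangle hnc hij hu (right_mem_segment ..) hip hpj ?_ hp hb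
        (S.lt_bound j)⟩
      intro m hm
      by_cases h1 : m = i
      · subst h1; exact Or.inr (left_mem_segment ..)
      by_cases h2 : m = j
      · subst h2; exact Or.inr (right_mem_segment ..)
      exact Or.inl (hK m hm h1 h2)
    exact ⟨_, dist_lt_of_not_collinear hnc, HasChain.of_adj hadj⟩
  push Not at hK
  -- The ratio `h / g` grows with the angle at `u` measured from `up`, so its minimum is the first
  -- tip met by the turning ray.
  obtain ⟨k, ⟨hkT, hki, hkj, hkp⟩, hkmin⟩ := Set.exists_min_image
    {m | S.tip m ∈ triangle u p v ∧ m ≠ i ∧ m ≠ j ∧ S.tip m ≠ p}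
    (fun m => h (S.tip m) / g (S.tip m)) (Set.toFinite _) hK
  have pos : ∀ m, S.tip m ∈ triangle u p v → m ≠ i → m ≠ j → S.tip m ≠ p →
      0 < f (S.tip m) ∧ 0 < g (S.tip m) ∧ 0 < h (S.tip m) := by
    rintro m ⟨r, s, t, hr, hs, ht, h1, hx⟩ hmi hmj hmp
    obtain ⟨e1, e2, e3⟩ := uniq r s t h1
    rw [← hx] at e1 e2 e3
    rw [e1, e2, e3]
    refine ⟨lt_of_le_of_ne hr ?_, lt_of_le_of_ne hs ?_, lt_of_le_of_ne ht ?_⟩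
    · rintro rfl
      rcases hj m ⟨s, t, hs, ht, by linarith, by rw [hx]; simp⟩ with h2 | h2
      exacts [hmp h2, hmj h2]
    · rintro rfl
      refine S.tips i j m hij hmi.symm hmj.symm ?_
      exact collinear_of_mem_segment (right_mem_segment ..)
        ⟨r, t, hr, ht, by linarith, by rw [hx]; simp [hu, hv]⟩
    · rintro rfl
      rcases hi m ⟨r, s, hr, hs, by linarith, by rw [hx]; simp⟩ with h2 | h2
      exacts [hmi h2, hmp h2]
  obtain ⟨f0, g0, h0⟩ := pos k hkT hki hkj hkp
  have fk1 : f (S.tip k) < 1 := by linarith [sum1 (S.tip k)]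
  set f₀ := f (S.tip k) with hf₀
  obtain ⟨α, hα0, hα1, hαg, hαh⟩ : ∃ α : ℝ, 0 < α ∧ α < 1 ∧ g (S.tip k) = (1 - f₀) * α ∧
      h (S.tip k) = (1 - f₀) * (1 - α) := by
    have hc : 0 < 1 - f₀ := by linarith
    refine ⟨g (S.tip k) / (1 - f₀), by positivity, ?_, by field_simp, ?_⟩
    · rw [div_lt_one hc]; linarith [sum1 (S.tip k)]
    · field_simp; linarith [sum1 (S.tip k)]
  have hα1' : 0 < 1 - α := by linarith
  have hf1' : 0 < 1 - f₀ := by linarith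
  set w : Plane := α • p + (1 - α) • v with hw
  have hk : S.tip k = f₀ • u + (1 - f₀) • w := by
    conv_lhs => rw [rep (S.tip k), ← hf₀, hαg, hαh]
    rw [hw]
    module
  have hkseg : S.tip k ∈ segment ℝ u w := ⟨f₀, 1 - f₀, f0.le, hf1'.le, by ring, hk.symm⟩
  have hwseg : w ∈ segment ℝ p v := ⟨α, 1 - α, hα0.le, hα1'.le, by ring, rfl⟩
  have subs₁ : triangle u p w ⊆ triangle u p v := by
    rintro y ⟨r, s, t, hr, hs, ht, h1, rfl⟩
    exact ⟨r, s + t * α, t * (1 - α), hr, by positivity, by positivity, by linear_combination h1,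
      by rw [hw]; module⟩
  have subs₂ : triangle (S.tip k) w v ⊆ triangle u p v :=
    triangle_subset hα0.le hα1.le f0.le fk1.le rfl hk
  have hbw : S.φ w < S.bound := by
    refine S.φ_lt_bound_of_mem_triangle (S.lt_bound i) hb (S.lt_bound j)
      (x := w) ⟨0, α, 1 - α, le_rfl, hα0.le, hα1'.le, by ring, ?_⟩
    rw [hw]; simp [hv]
  have huw : S.Free u w := by
    refine S.free_of_triangle ?_ hki.symm hu hkseg hip
      (hpj.mono (left_mem_segment ..) hwseg) ?_ (fun m hm => (hp m hm).mono_left subs₁) hb hbw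
    · rw [not_collinear_iff_det] at hnc ⊢
      intro h0
      apply mul_ne_zero hα1'.ne' hnc
      rw [← h0, hw]
      simp
      ring
    · intro m hm
      by_cases h1 : m = i
      · subst h1; exact Or.inr (left_mem_segment ..)
      by_cases h2 : S.tip m = p
      · exact Or.inl h2
      obtain ⟨r, s, t, hr, hs, ht, hrst, hx⟩ := hm
      have hx' : S.tip m = r • u + (s + t * α) • p + (t * (1 - α)) • v := by
        rw [hx, hw]; module
      obtain ⟨e1, e2, e3⟩ := uniq r (s + t * α) (t * (1 - α)) (by linear_combination hrst)
      rw [← hx'] at e1 e2 e3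
      have hmT : S.tip m ∈ triangle u p v :=
        ⟨_, _, _, hr, by positivity, by positivity, by linear_combination hrst, hx'⟩
      by_cases h3 : m = j
      · rw [h3, ← hv, hv1] at e3
        have h4 := sum1 v
        rw [h3, ← hv] at e1 e2
        nlinarith
      obtain ⟨p1, p2, p3⟩ := pos m hmT h1 h3 h2
      have hmin := hkmin m ⟨hmT, h1, h3, h2⟩
      rw [div_le_div_iff₀ g0 p2, hαg, hαh, e2, e3] at hmin
      -- A positive weight at `p` would give `m` a smaller ratio than `k`.
      have hs0 : s = 0 := by
        have h5 : (1 - f₀) * (1 - α) * s ≤ 0 := by linarith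
        have h6 : 0 < (1 - f₀) * (1 - α) := mul_pos hf1' hα1'
        nlinarith
      exact Or.inr ⟨r, t, hr, ht, by linarith, by rw [hx, hs0]; simp⟩
  have hadj : S.visGraph.Adj i k :=
    ⟨hki.symm, huw.mono (left_mem_segment ..) hkseg⟩
  have hwp : w ≠ p := by
    intro h'
    have := (uniq 0 α (1 - α) (by ring)).2.1
    rw [zero_smul, zero_add, ← hw, h', gp] at this
    linarith
  have hwv : w ≠ v := by
    intro h'
    have := (uniq 0 α (1 - α) (by ring)).2.2
    rw [zero_smul, zero_add, ← hw, h', hv1] at this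
    linarith
  -- Since `w` is not a tip, the condition on slits starting at the bend is vacuous in the
  -- recursion.
  have hwtip : ∀ m, S.tip m ≠ w := by
    intro m hm
    rcases hj m (by rw [hm]; exact hwseg) with h1 | h1
    · exact hwp (hm.symm.trans h1)
    · exact hwv (by rw [← hm, h1])
  -- The smaller triangle misses `u`, where `f = 1`, so the induction measure drops.
  have hutri : ∀ x ∈ triangle (S.tip k) w v, f x < 1 := by
    rintro x ⟨r, s, t, hr, hs, ht, h1, rfl⟩
    have e := (uniq (r * f₀) ((r * (1 - f₀) + s) * α) ((r * (1 - f₀) + s) * (1 - α) + t)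
      (by linear_combination h1)).1
    have : r • S.tip k + s • w + t • v = (r * f₀) • u + ((r * (1 - f₀) + s) * α) • p +
        ((r * (1 - f₀) + s) * (1 - α) + t) • v := by
      rw [hk, hw]; module
    rw [this, e]
    nlinarith
  obtain ⟨r, hr, hchain⟩ := ih (Set.ncard {m | S.tip m ∈ triangle (S.tip k) w v}) (by
      rw [← hn]
      refine Set.ncard_lt_ncard ⟨fun m hm => subs₂ hm, fun hsub => ?_⟩ (Set.toFinite _)
      have := hutri _ (hsub (show S.tip i ∈ triangle u p v from
        ⟨1, 0, 0, by norm_num, by norm_num, by norm_num, by norm_num, by simp [hu]⟩))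
      rw [← hu, fu] at this
      exact lt_irrefl _ this)
    (i := k) (p := w) hkj (by
      rw [not_collinear_iff_det] at hnc ⊢
      intro h0
      apply mul_ne_zero (mul_ne_zero f0.ne' hα0.ne') hnc
      rw [← h0, hk, hw]
      simp
      ring)
    (huw.mono hkseg (right_mem_segment ..)) (hpj.mono hwseg (right_mem_segment ..))
    (by
      intro m hm
      have hm' : S.tip m ∈ segment ℝ u w :=
        (convex_segment u w).segment_subset hkseg (right_mem_segment ..) hm
      by_contra hcon
      push Not at hcon
      have hmi : m ≠ i := by
        rintro rfl
        obtain ⟨a, b, ha, hb', hab, hx⟩ := hm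
        have := hutri u ⟨a, b, 0, ha, hb', le_rfl, by linarith, by
          rw [hx]; simp [hu]⟩
        linarith
      exact S.tips i k m hki.symm hmi.symm hcon.1.symm (collinear_of_mem_segment hkseg hm'))
    (by
      intro m hm
      rcases hj m ((convex_segment p v).segment_subset hwseg (right_mem_segment ..) hm) with h1 | h1
      · exfalso
        obtain ⟨a, b, ha, hb', hab, hx⟩ := hm
        have e := (uniq 0 (a * α) (a * (1 - α) + b) (by linear_combination hab)).2.1
        have : p = (0 : ℝ) • u + (a * α) • p + (a * (1 - α) + b) • v := by
          conv_lhs => rw [← h1, ← hx]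
          rw [hw]; module
        rw [← this, gp] at e
        nlinarith
      · exact Or.inr h1)
    (fun m hm => absurd hm (hwtip m)) hbw rfl
  refine ⟨_, ?_, (HasChain.of_adj hadj).trans S.tipDist_nonneg hchain⟩
  have d1 : dist u (S.tip k) + dist (S.tip k) w = dist u w := dist_add_dist_of_mem_segment hkseg
  have d2 : dist p w + dist w v = dist p v := dist_add_dist_of_mem_segment hwseg
  have d3 := dist_triangle u p w
  have d4 : S.tipDist s(i, k) = dist u (S.tip k) := rfl
  linarith

end SlitSystem

/-! ### Connectedness of the visibility graph of the tips -/

/-- In oblique coordinates, the segments from `(a, 0)` to `(0, c)` and from `(b, 0)` to `(0, d)`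
cross; `l` and `m` locate the crossing. -/
theorem exists_common_ratio {a b c d : ℝ} (ha : 0 < a) (hab : a < b) (hd : 0 < d) (hdc : d < c) :
    ∃ l m : ℝ, 0 < l ∧ l < 1 ∧ 0 < m ∧ m < 1 ∧ l * a = m * b ∧ (1 - l) * c = (1 - m) * d := by
  have hb : 0 < b := ha.trans hab
  have hc : 0 < c := hd.trans hdc
  have hcd : 0 < c - d := sub_pos.2 hdc
  have hD : 0 < b * c - a * d := by nlinarith
  have hD' := hD.ne'
  refine ⟨b * (c - d) / (b * c - a * d), a * (c - d) / (b * c - a * d), by positivity, ?_,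
    by positivity, ?_, ?_, ?_⟩
  · rw [div_lt_one hD]; nlinarith
  · rw [div_lt_one hD]; nlinarith
  · field_simp
  · rw [one_sub_div hD', one_sub_div hD']; ring

namespace SlitSystem

variable {ι : Type*} (S : SlitSystem ι)

theorem φ_tip_lt_of_mem_slit {i : ι} {x : Plane} (h : x ∈ S.slit i) : S.φ (S.tip i) < S.φ x := by
  rw [slit_eq] at h
  obtain ⟨t, ⟨h0, h1⟩, rfl⟩ := h
  have := S.lt_finish i
  simp only [AffineMap.lineMap_apply, vsub_eq_sub, vadd_eq_add, map_add, map_smul, map_sub,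
    smul_eq_mul]
  nlinarith

theorem slit_subset (i : ι) : S.slit i ⊆ segment ℝ (S.tip i) (S.finish i) :=
  openSegment_subset_segment ..

theorem tip_notMem_slit (i k : ι) : S.tip i ∉ S.slit k := by
  intro h
  by_cases hik : i = k
  · subst hik
    exact lt_irrefl _ (S.φ_tip_lt_of_mem_slit h)
  · refine S.tip_off i k hik ?_
    have := (mem_segment_iff_wbtw.1 (S.slit_subset k h)).collinear
    rwa [Set.insert_comm] at this

/-- A ray from a tip meets every other slit at most once. -/
theorem ray_inter_slit {i l : ι} (hil : i ≠ l) {e : Plane} {s t : ℝ}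
    (hs : S.tip i + s • e ∈ S.slit l) (ht : S.tip i + t • e ∈ S.slit l) : s = t := by
  by_contra hne
  refine not_collinear_iff_det.1 (S.tip_off i l hil) ?_
  obtain ⟨a, b, -, -, hab, h1⟩ := hs
  obtain ⟨c, d, -, -, hcd, h2⟩ := ht
  have h10 := congrFun (congrArg WithLp.ofLp h1) 0
  have h11 := congrFun (congrArg WithLp.ofLp h1) 1
  have h20 := congrFun (congrArg WithLp.ofLp h2) 0
  have h21 := congrFun (congrArg WithLp.ofLp h2) 1
  simp only [PiLp.add_apply, PiLp.smul_apply, smul_eq_mul] at h10 h11 h20 h21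
  obtain rfl : a = 1 - b := by linarith
  obtain rfl : c = 1 - d := by linarith
  apply mul_left_cancel₀ (sub_ne_zero.2 hne)
  set x0 := (S.tip i) 0
  set x1 := (S.tip i) 1
  set y0 := (S.tip l) 0
  set y1 := (S.tip l) 1
  set w0 := (S.finish l) 0
  set w1 := (S.finish l) 1
  linear_combination s * ((w1 - y1) * h20 - (w0 - y0) * h21) -
    t * ((w1 - y1) * h10 - (w0 - y0) * h11)

/-- From each tip that is not leftmost one sees a tip further left. -/
theorem exists_adj_lt [Finite ι] (ψ : Plane →ₗ[ℝ] ℝ) (hψ : ∀ x, S.φ x = 0 → ψ x = 0 → x = 0)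
    (i : ι) (hi : ∃ k, S.φ (S.tip k) < S.φ (S.tip i)) :
    ∃ q, S.φ (S.tip q) < S.φ (S.tip i) ∧ S.visGraph.Adj i q := by
  by_contra hcon
  push Not at hcon
  set z := S.tip i with hz
  set K : Set ι := {k | S.φ (S.tip k) < S.φ z} with hK
  -- Directions from `z` are scaled so that `φ` drops at unit speed: `e q` points to the tip of `q`,
  -- `p q` is its parameter and `σ q` its slope.
  set p : ι → ℝ := fun q => S.φ z - S.φ (S.tip q) with hp
  set e : ι → Plane := fun q => (p q)⁻¹ • (S.tip q - z) with he
  set σ : ι → ℝ := fun q => ψ (e q) with hσ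
  have p_pos : ∀ q ∈ K, 0 < p q := fun q hq => sub_pos.2 hq
  have φe : ∀ q ∈ K, S.φ (e q) = -1 := by
    intro q hq
    have := (p_pos q hq).ne'
    simp only [he, map_smul, map_sub, smul_eq_mul]
    rw [show S.φ (S.tip q) - S.φ z = -p q by simp [hp]]
    field_simp
  have tip_eq : ∀ q ∈ K, S.tip q = z + p q • e q := by
    intro q hq
    have := (p_pos q hq).ne'
    simp only [he, smul_smul, mul_inv_cancel₀ this, one_smul, add_sub_cancel]
  have ne_i : ∀ q ∈ K, q ≠ i := by
    rintro q hq rfl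
    exact lt_irrefl (S.φ z) hq
  have combo : ∀ j ∈ K, ∀ m ∈ K, ∀ k ∈ K, ∀ θ : ℝ, σ m = (1 - θ) * σ j + θ * σ k →
      e m = (1 - θ) • e j + θ • e k := by
    intro j hj m hm k hk θ h
    rw [← sub_eq_zero]
    apply hψ
    · simp only [map_sub, map_add, map_smul, φe _ hj, φe _ hm, φe _ hk, smul_eq_mul]; ring
    · simp only [map_sub, map_add, map_smul, smul_eq_mul]
      simp only [hσ] at h
      rw [h]; ring
  have σ_inj : ∀ j ∈ K, ∀ k ∈ K, σ j = σ k → j = k := by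
    intro j hj k hk h
    by_contra hne
    have hjk : e j = e k := by
      simpa using combo k hk j hj k hk 0 (by rw [h]; ring)
    refine S.tips i j k (ne_i j hj).symm (ne_i k hk).symm hne ?_
    rw [collinear_iff_of_mem (p₀ := z) (by simp [hz])]
    refine ⟨e j, ?_⟩
    simp only [Set.mem_insert_iff, Set.mem_singleton_iff, forall_eq_or_imp, forall_eq]
    refine ⟨⟨0, by simp [hz]⟩, ⟨p j, ?_⟩, ⟨p k, ?_⟩⟩
    · rw [vadd_eq_add, add_comm]; exact tip_eq j hj
    · rw [vadd_eq_add, add_comm, hjk]; exact tip_eq k hk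
  clear_value σ e p
  set B : ι → ι → ℝ → Prop := fun q l ρ => 0 < ρ ∧ ρ < p q ∧ z + ρ • e q ∈ S.slit l with hB
  have mem_K : ∀ q ∈ K, ∀ l (ρ : ℝ), 0 < ρ → z + ρ • e q ∈ S.slit l → l ∈ K := by
    intro q hq l ρ h0 h2
    have h := S.φ_tip_lt_of_mem_slit h2
    simp only [map_add, map_smul, φe q hq, smul_eq_mul] at h
    show S.φ (S.tip l) < S.φ z
    linarith
  have blocked : ∀ q ∈ K, ∃ l ρ, B q l ρ := by
    intro q hq
    have h1 := hcon q hq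
    have h2 : ¬ S.Free z (S.tip q) := fun h => h1 ⟨(ne_i q hq).symm, h⟩
    simp only [Free, not_forall, Set.not_disjoint_iff] at h2
    obtain ⟨l, x, hx, hxl⟩ := h2
    rw [segment_eq_image'] at hx
    obtain ⟨s, ⟨h0, h1⟩, rfl⟩ := hx
    beta_reduce at hxl
    have hpq := p_pos q hq
    have hs0 : s ≠ 0 := by
      rintro rfl
      rw [zero_smul, add_zero] at hxl
      exact S.tip_notMem_slit i l hxl
    have hs1 : s ≠ 1 := by
      rintro rfl
      rw [one_smul, add_sub_cancel] at hxl
      exact S.tip_notMem_slit q l hxl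
    refine ⟨l, s * p q, mul_pos (lt_of_le_of_ne h0 hs0.symm) hpq, ?_, ?_⟩
    · exact mul_lt_of_lt_one_left hpq (lt_of_le_of_ne h1 hs1)
    · simpa only [he, smul_smul, mul_assoc, mul_inv_cancel₀ hpq.ne', mul_one] using hxl
  -- The first slit hit on the way from `z` to the tip of `q`; outside `K` the values are arbitrary.
  have nearest : ∀ q, ∃ l ρ, q ∈ K → (B q l ρ ∧ ∀ l' ρ', B q l' ρ' → ρ ≤ ρ') := by
    intro q
    by_cases hq : q ∈ K
    · have hfin : (⋃ l, {ρ | B q l ρ}).Finite := by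
        refine Set.finite_iUnion fun l => Set.Subsingleton.finite ?_
        intro s hs t ht
        exact S.ray_inter_slit (ne_i l (mem_K q hq l s hs.1 hs.2.2)).symm hs.2.2 ht.2.2
      obtain ⟨l, ρ, h⟩ := blocked q hq
      obtain ⟨ρ₀, h0, hmin⟩ := Set.exists_min_image _ id hfin ⟨ρ, Set.mem_iUnion.2 ⟨l, h⟩⟩
      obtain ⟨l₀, hl₀⟩ := Set.mem_iUnion.1 h0
      exact ⟨l₀, ρ₀, fun _ => ⟨hl₀, fun l' ρ' h' => hmin ρ' (Set.mem_iUnion.2 ⟨l', h'⟩)⟩⟩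
    · exact ⟨q, 0, fun h => absurd h hq⟩
  choose n ρ hn using nearest
  have nK : ∀ q ∈ K, n q ∈ K := fun q hq => mem_K q hq _ _ (hn q hq).1.1 (hn q hq).1.2.2
  have n_ne : ∀ q ∈ K, n q ≠ q := by
    intro q hq h
    have h1 := (hn q hq).1
    rw [h] at h1
    refine S.tip_off i q (ne_i q hq).symm ?_
    have h2 := S.slit_subset q h1.2.2
    by_contra hnc
    rw [not_collinear_iff_det] at hnc
    apply hnc
    obtain ⟨a, b, -, -, hab, h3⟩ := h2
    have h30 := congrFun (congrArg WithLp.ofLp h3) 0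
    have h31 := congrFun (congrArg WithLp.ofLp h3) 1
    have h40 := congrFun (congrArg WithLp.ofLp (tip_eq q hq)) 0
    have h41 := congrFun (congrArg WithLp.ofLp (tip_eq q hq)) 1
    simp only [PiLp.add_apply, PiLp.smul_apply, smul_eq_mul] at h30 h31 h40 h41
    obtain rfl : a = 1 - b := by linarith
    have hb : b ≠ 0 := by
      rintro rfl
      have : ρ q = p q := by
        have h5 : z + ρ q • e q = z + p q • e q := by rw [← h3, ← tip_eq q hq]; simp
        have h6 := congrArg S.φ h5
        simp only [map_add, map_smul, φe q hq, smul_eq_mul] at h6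
        linarith
      exact h1.2.1.ne this
    apply mul_left_cancel₀ hb
    linear_combination (e q 0 * h31 - e q 1 * h30) * p q +
      b * ((S.finish q 1 - S.tip i 1) * h40 - (S.finish q 0 - S.tip i 0) * h41) +
      p q * (1 - b) * (e q 1 * h40 - e q 0 * h41)
  -- Slit `k` meets ray `j` at `r`, and its tip lies on ray `k`. Ray `m` lies between them or is ray
  -- `k`, so it is crossed at the `τ` whose inverse interpolates `1 / r` and `1 / p k`. The first
  -- obstacle on ray `m` is a different slit, so it comes earlier.
  have cross : ∀ j ∈ K, ∀ m ∈ K, ∀ k ∈ K, ∀ θ r : ℝ, 0 < θ → θ ≤ 1 →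
      σ m = (1 - θ) * σ j + θ * σ k → 0 < r → z + r • e j ∈ S.slit k → n m ≠ k →
      ∃ τ, ρ m < τ ∧ z + τ • e m ∈ segment ℝ (S.tip k) (S.finish k) := by
    intro j hj m hm k hk θ r hθ0 hθ1 hθ hr hrk hnk
    have hem := combo j hj m hm k hk θ hθ
    have hpk := p_pos k hk
    have hθ1' := sub_nonneg.2 hθ1
    have hD : 0 < (1 - θ) / r + θ / p k := by positivity
    set τ := ((1 - θ) / r + θ / p k)⁻¹ with hτ
    have hτ0 : 0 < τ := by positivity
    have hw : τ * ((1 - θ) / r) + τ * (θ / p k) = 1 := by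
      rw [← mul_add, hτ, inv_mul_cancel₀ hD.ne']
    have hpt : z + τ • e m = (τ * ((1 - θ) / r)) • (z + r • e j) + (τ * (θ / p k)) • S.tip k := by
      have e1 : τ * ((1 - θ) / r) * r = τ * (1 - θ) := by field_simp
      have e2 : τ * (θ / p k) * p k = τ * θ := by field_simp
      rw [tip_eq k hk, smul_add, smul_add, smul_smul, smul_smul, e1, e2, hem]
      have : z = (τ * ((1 - θ) / r)) • z + (τ * (θ / p k)) • z := by rw [← add_smul, hw, one_smul]
      nth_rewrite 1 [this]
      module
    have hseg : z + τ • e m ∈ segment ℝ (z + r • e j) (S.tip k) :=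
      ⟨_, _, by positivity, by positivity, hw, hpt.symm⟩
    refine ⟨τ, ?_, (convex_segment _ _).segment_subset (S.slit_subset k hrk)
      (left_mem_segment ..) hseg⟩
    rcases lt_or_ge τ (p m) with hlt | hge
    · have hθlt : 0 < 1 - θ := by
        refine lt_of_le_of_ne hθ1' fun h1 => ?_
        obtain rfl : θ = 1 := by linarith
        have hmk : m = k := σ_inj m hm k hk (by rw [hθ]; ring)
        subst hmk
        rw [hτ] at hlt
        simp at hlt
      have hslit : z + τ • e m ∈ S.slit k :=
        mem_openSegment_of_mem_openSegment hrk (left_mem_segment ..)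
          ⟨_, _, by positivity, by positivity, hw, hpt.symm⟩
      refine lt_of_le_of_ne ((hn m hm).2 k τ ⟨hτ0, hlt, hslit⟩) fun heq => ?_
      refine Set.disjoint_left.1 (S.disj (n m) k hnk) (hn m hm).1.2.2 ?_
      rw [heq]; exact hslit
    · exact (hn m hm).1.2.1.trans_le hge
  obtain ⟨j₀, hj₀, hj₀min⟩ := Set.exists_min_image K σ (Set.toFinite _) hi
  have σ_ne : ∀ q ∈ K, σ (n q) ≠ σ q := fun q hq h => n_ne q hq (σ_inj _ (nK q hq) _ hq h)
  -- Let `j` be the last direction whose blocking slit has a tip of larger slope, and `m` the next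
  -- direction, blocked by a slit whose tip has smaller slope. Both slits span the wedge between the
  -- two rays; `n j` is nearer to `z` on ray `j` and `n m` on ray `m`, so they cross.
  obtain ⟨j, ⟨hj, hjup⟩, hjmax⟩ := Set.exists_max_image {q | q ∈ K ∧ σ q < σ (n q)} σ
    (Set.toFinite _) ⟨j₀, hj₀, lt_of_le_of_ne (hj₀min _ (nK _ hj₀)) (σ_ne _ hj₀).symm⟩
  obtain ⟨m, ⟨hm, hjm⟩, hmmin⟩ := Set.exists_min_image {q | q ∈ K ∧ σ j < σ q} σ
    (Set.toFinite _) ⟨n j, nK j hj, hjup⟩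
  have hmn : σ (n m) < σ m := by
    refine lt_of_le_of_ne (not_lt.1 fun h => ?_) (σ_ne m hm)
    exact absurd (hjmax m ⟨hm, h⟩) (not_le.2 hjm)
  have hnmj : σ (n m) ≤ σ j := by
    by_contra h
    exact absurd (hmmin _ ⟨nK m hm, not_le.1 h⟩) (not_le.2 hmn)
  have hmnj : σ m ≤ σ (n j) := hmmin _ ⟨nK j hj, hjup⟩
  have hnn : n j ≠ n m := fun h => by rw [h] at hjup; exact absurd hjup (not_lt.2 hnmj)
  obtain ⟨⟨rj0, -, rj⟩, -⟩ := hn j hj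
  obtain ⟨⟨rm0, -, rm⟩, -⟩ := hn m hm
  have d1 : 0 < σ (n j) - σ j := sub_pos.2 hjup
  have d2 : 0 < σ m - σ (n m) := sub_pos.2 hmn
  obtain ⟨τ, hτ, hτs⟩ := cross j hj m hm (n j) (nK j hj) ((σ m - σ j) / (σ (n j) - σ j)) (ρ j)
    (div_pos (sub_pos.2 hjm) d1) (by rw [div_le_one d1]; linarith) (by field_simp; ring)
    rj0 rj hnn.symm
  obtain ⟨τ', hτ', hτs'⟩ := cross m hm j hj (n m) (nK m hm) ((σ m - σ j) / (σ m - σ (n m))) (ρ m)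
    (div_pos (sub_pos.2 hjm) d2) (by rw [div_le_one d2]; linarith) (by field_simp; ring)
    rm0 rm hnn
  obtain ⟨l, μ, hl0, hl1, hμ0, hμ1, h1, h2⟩ := exists_common_ratio rj0 hτ' rm0 hτ
  have hx₁ : z + (l * ρ j) • e j + ((1 - l) * τ) • e m ∈ S.slit (n j) :=
    mem_openSegment_of_mem_openSegment rj hτs ⟨l, 1 - l, hl0, by linarith, by ring, by module⟩
  have hx₂ : z + (l * ρ j) • e j + ((1 - l) * τ) • e m ∈ S.slit (n m) := by
    rw [h1, h2]
    exact mem_openSegment_of_mem_openSegment rm hτs'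
      ⟨1 - μ, μ, by linarith, hμ0, by ring, by module⟩
  exact Set.disjoint_left.1 (S.disj (n j) (n m) hnn) hx₁ hx₂

end SlitSystem

/-! ### Extending segments to slits -/

theorem openSegment_lineMap (a b : Plane) {r : ℝ} (hr : 0 < r) :
    openSegment ℝ a (AffineMap.lineMap a b r) = AffineMap.lineMap a b '' Set.Ioo (0 : ℝ) r := by
  rw [openSegment_eq_image_lineMap]
  ext x
  constructor
  · rintro ⟨t, ⟨h0, h1⟩, rfl⟩
    refine ⟨t * r, ⟨by positivity, mul_lt_of_lt_one_left hr h1⟩, ?_⟩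
    simp only [AffineMap.lineMap_apply, vsub_eq_sub, vadd_eq_add]
    module
  · rintro ⟨t, ⟨h0, h1⟩, rfl⟩
    refine ⟨t / r, ⟨by positivity, (div_lt_one hr).2 h1⟩, ?_⟩
    simp only [AffineMap.lineMap_apply, vsub_eq_sub, vadd_eq_add, add_sub_cancel_right, smul_smul,
      div_mul_cancel₀ _ hr.ne']

/-- Two different parameters would put `a` itself on the line `cd`. -/
theorem line_inter_line {a b c d : Plane} (h : ¬ Collinear ℝ {a, c, d}) {t t' s s' : ℝ}
    (h₁ : AffineMap.lineMap a b t = AffineMap.lineMap c d s)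
    (h₂ : AffineMap.lineMap a b t' = AffineMap.lineMap c d s') : t = t' := by
  by_contra hne
  rw [not_collinear_iff_det] at h
  apply h
  apply mul_left_cancel₀ (sub_ne_zero.2 hne)
  have h10 := congrFun (congrArg WithLp.ofLp h₁) 0
  have h11 := congrFun (congrArg WithLp.ofLp h₁) 1
  have h20 := congrFun (congrArg WithLp.ofLp h₂) 0
  have h21 := congrFun (congrArg WithLp.ofLp h₂) 1
  simp only [AffineMap.lineMap_apply, vsub_eq_sub, vadd_eq_add, PiLp.add_apply, PiLp.smul_apply,
    PiLp.sub_apply, smul_eq_mul] at h10 h11 h20 h21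
  linear_combination t' * ((c 0 - d 0) * h11 - (c 1 - d 1) * h10) -
    t * ((c 0 - d 0) * h21 - (c 1 - d 1) * h20)

/-- Disjoint segments in general position can be extended on one side to a system of slits. -/
theorem exists_slitSystem {ι : Type*} [Finite ι] (a b : ι → Plane) (φ : Plane →ₗ[ℝ] ℝ)
    (hab : ∀ i, φ (a i) < φ (b i))
    (tips : ∀ i j k, i ≠ j → i ≠ k → j ≠ k → ¬ Collinear ℝ {a i, a j, a k})
    (off : ∀ i k, i ≠ k → ¬ Collinear ℝ {a i, a k, b k})
    (disj : ∀ i k, i ≠ k → Disjoint (openSegment ℝ (a i) (b i)) (openSegment ℝ (a k) (b k))) :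
    ∃ S : SlitSystem ι, S.tip = a ∧ S.φ = φ ∧ ∀ k, openSegment ℝ (a k) (b k) ⊆ S.slit k := by
  have := Fintype.ofFinite ι
  classical
  obtain ⟨X, hX⟩ : ∃ X, ∀ i, φ (b i) < X := by
    obtain ⟨Y, hY⟩ := (Set.finite_range fun i => φ (b i)).bddAbove
    exact ⟨Y + 1, fun i => (hY ⟨i, rfl⟩).trans_lt (lt_add_one Y)⟩
  set pt : ι → ℝ → Plane := fun i t => AffineMap.lineMap (a i) (b i) t with hpt
  have φpt : ∀ i t, φ (pt i t) = φ (a i) + t * (φ (b i) - φ (a i)) := by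
    intro i t
    simp only [hpt, AffineMap.lineMap_apply, vsub_eq_sub, vadd_eq_add, map_add, map_smul, map_sub,
      smul_eq_mul]
    ring
  have hd : ∀ i, 0 < φ (b i) - φ (a i) := fun i => sub_pos.2 (hab i)
  set T : ι → ℝ := fun i => (X - φ (a i)) / (φ (b i) - φ (a i)) with hT
  have φT : ∀ i, φ (pt i (T i)) = X := by
    intro i
    have := (hd i).ne'
    rw [φpt, hT]
    field_simp
    ring
  have one_lt_T : ∀ i, 1 < T i := by
    intro i
    rw [hT, one_lt_div (hd i)]
    linarith [hX i]
  have inter : ∀ j k, j ≠ k → ∀ t t' s s', pt j t = pt k s → pt j t' = pt k s' → t = t' :=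
    fun j k hjk t t' s s' h₁ h₂ => line_inter_line (off j k hjk) h₁ h₂
  -- Candidate lengths: the original one, the one reaching level `X`, and those at which ray `j`
  -- meets the line of another segment. They are finitely many, so some disjoint choice has maximal
  -- total length.
  set R : ι → Set ℝ := fun j =>
    {1, T j} ∪ ⋃ k, {t | j ≠ k ∧ 1 ≤ t ∧ t ≤ T j ∧ ∃ s, pt j t = pt k s} with hR
  have R_fin : ∀ j, (R j).Finite := by
    intro j
    refine (Set.toFinite _).union (Set.finite_iUnion fun k => Set.Subsingleton.finite ?_)
    rintro t ⟨hjk, -, -, s, hs⟩ t' ⟨-, -, -, s', hs'⟩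
    exact inter j k hjk t t' s s' hs hs'
  have one_le_R : ∀ j, ∀ t ∈ R j, 1 ≤ t ∧ t ≤ T j := by
    rintro j t (ht | ht)
    · rcases ht with rfl | rfl
      · exact ⟨le_rfl, (one_lt_T j).le⟩
      · exact ⟨(one_lt_T j).le, le_rfl⟩
    · obtain ⟨k, -, h1, h2, -⟩ := Set.mem_iUnion.1 ht
      exact ⟨h1, h2⟩
  set W : Set (ι → ℝ) := {r | r ∈ Set.univ.pi R ∧
    ∀ j k, j ≠ k → Disjoint (pt j '' Set.Ioo 0 (r j)) (pt k '' Set.Ioo 0 (r k))} with hW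
  have W_fin : W.Finite := (Set.Finite.pi fun j => R_fin j).subset fun r hr => hr.1
  have W_ne : W.Nonempty := by
    refine ⟨fun _ => 1, fun j _ => Or.inl (Or.inl rfl), fun j k hjk => ?_⟩
    rw [← openSegment_eq_image_lineMap, ← openSegment_eq_image_lineMap]
    exact disj j k hjk
  obtain ⟨r, ⟨hrR, hrd⟩, hmax⟩ := Set.exists_max_image W (fun r => ∑ j, r j) W_fin W_ne
  have r_bd : ∀ j, 1 ≤ r j ∧ r j ≤ T j := fun j => one_le_R j _ (hrR j trivial)
  have r_pos : ∀ j, 0 < r j := fun j => one_pos.trans_le (r_bd j).1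
  have finish : ∀ j, r j = T j ∨ ∃ k, pt j (r j) ∈ pt k '' Set.Ioo 0 (r k) := by
    intro j
    by_contra hcon
    push Not at hcon
    obtain ⟨hne, hno⟩ := hcon
    -- Otherwise slit `j` could grow to the next candidate `t'`: it hits nothing at `r j`, and meets
    -- no other line strictly between.
    obtain ⟨t', ⟨ht'R, ht'⟩, hmin⟩ := Set.exists_min_image {t | t ∈ R j ∧ r j < t} id
      ((R_fin j).subset fun t ht => ht.1)
      ⟨T j, Or.inl (Or.inr rfl), lt_of_le_of_ne (r_bd j).2 hne⟩
    have new : ∀ k, j ≠ k → Disjoint (pt j '' Set.Ioo 0 t') (pt k '' Set.Ioo 0 (r k)) := by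
      intro k hjk
      rw [Set.disjoint_left]
      rintro x ⟨t, ⟨h0, h1⟩, rfl⟩ ⟨s, hs, he⟩
      rcases lt_trichotomy t (r j) with h | h | h
      · exact Set.disjoint_left.1 (hrd j k hjk) ⟨t, ⟨h0, h⟩, rfl⟩ ⟨s, hs, he⟩
      · exact hno k ⟨s, hs, by rw [← h]; exact he⟩
      · refine absurd (hmin t ⟨Or.inr (Set.mem_iUnion.2 ⟨k, hjk, ?_, ?_, s, he.symm⟩), h⟩)
          (not_le.2 h1)
        · exact (r_bd j).1.trans h.le
        · exact h1.le.trans (one_le_R j _ ht'R).2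
    have hmem : Function.update r j t' ∈ W := by
      refine ⟨fun k _ => ?_, fun i k hik => ?_⟩
      · by_cases hk : k = j
        · subst hk; rw [Function.update_self]; exact ht'R
        · rw [Function.update_of_ne hk]; exact hrR k trivial
      · by_cases hi : i = j
        · subst hi
          rw [Function.update_self, Function.update_of_ne hik.symm]
          exact new k hik
        · rw [Function.update_of_ne hi]
          by_cases hk : k = j
          · subst hk
            rw [Function.update_self]
            exact (new i hik.symm).symm
          · rw [Function.update_of_ne hk]
            exact hrd i k hik
    refine absurd (hmax _ hmem) (not_le.2 ?_)
    refine Finset.sum_lt_sum (fun k _ => ?_) ⟨j, Finset.mem_univ j, ?_⟩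
    · by_cases hk : k = j
      · subst hk; rw [Function.update_self]; exact ht'.le
      · rw [Function.update_of_ne hk]
    · rw [Function.update_self]; exact ht'
  have seg : ∀ k, openSegment ℝ (a k) (pt k (r k)) = pt k '' Set.Ioo 0 (r k) :=
    fun k => openSegment_lineMap _ _ (r_pos k)
  refine ⟨⟨a, fun k => pt k (r k), φ, X, ?_, fun i => (hab i).trans (hX i), tips, ?_, ?_, ?_⟩,
    rfl, rfl, ?_⟩
  · intro i
    rw [φpt]
    have := mul_pos (r_pos i) (hd i)
    linarith
  · intro i k hik
    have h := off i k hik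
    rw [not_collinear_iff_det] at h ⊢
    intro h0
    apply mul_ne_zero (r_pos k).ne' h
    rw [← h0, hpt]
    simp only [AffineMap.lineMap_apply, vsub_eq_sub, vadd_eq_add, PiLp.add_apply, PiLp.smul_apply,
      PiLp.sub_apply, smul_eq_mul]
    ring
  · intro i k hik
    rw [seg, seg]
    exact hrd i k hik
  · intro j
    rcases finish j with h | ⟨k, hk⟩
    · left; rw [h, φT]
    · right; exact ⟨k, by rw [seg]; exact hk⟩
  · intro k
    show _ ⊆ openSegment ℝ (a k) (pt k (r k))
    rw [seg, openSegment_eq_image_lineMap]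
    exact Set.image_mono (Set.Ioo_subset_Ioo_right (r_bd k).1)

/-! ### The shortest chain is a non-crossing perfect matching -/

namespace SlitSystem

variable {ι : Type*} (S : SlitSystem ι)

theorem eq_or_eq_of_tip_mem {i j m : ι} (hij : i ≠ j)
    (h : S.tip m ∈ segment ℝ (S.tip i) (S.tip j)) : m = i ∨ m = j := by
  by_contra hcon
  push Not at hcon
  exact S.tips i m j hcon.1.symm hij hcon.2 (mem_segment_iff_wbtw.1 h).collinear

/-- Two edges at a tip on the same side of its slit can be replaced by a shorter chain. -/
theorem exists_chain_lt_of_same_side [Fintype ι] [DecidableEq ι] {i j k : ι}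
    (hij : S.visGraph.Adj i j) (hik : S.visGraph.Adj i k) (hjk : j ≠ k)
    (hside : 0 < ((S.tip j 0 - S.tip i 0) * (S.finish i 1 - S.tip i 1) -
        (S.tip j 1 - S.tip i 1) * (S.finish i 0 - S.tip i 0)) *
      ((S.tip k 0 - S.tip i 0) * (S.finish i 1 - S.tip i 1) -
        (S.tip k 1 - S.tip i 1) * (S.finish i 0 - S.tip i 0))) :
    ∃ r < dist (S.tip j) (S.tip i) + dist (S.tip i) (S.tip k),
      HasChain S.visGraph S.tipDist j k r := by
  refine S.exists_chain_lt hjk (S.tips _ _ _ hij.ne.symm hjk hik.ne) hij.2.symm hik.2 ?_ ?_ ?_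
    (S.lt_bound i)
  · intro m hm
    exact (S.eq_or_eq_of_tip_mem hij.ne.symm hm).imp_right fun h => by rw [h]
  · intro m hm
    exact (S.eq_or_eq_of_tip_mem hik.ne hm).imp_left fun h => by rw [h]
  · intro m hm
    obtain rfl := S.tip_injective hm
    rw [Set.disjoint_left]
    rintro x ⟨r, s, t, hr, hs, ht, h1, hx⟩ hxm
    have hxm' := hxm
    obtain ⟨c, d, -, -, hcd, hx'⟩ := hxm
    have h10 := congrFun (congrArg WithLp.ofLp hx) 0
    have h11 := congrFun (congrArg WithLp.ofLp hx) 1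
    have h20 := congrFun (congrArg WithLp.ofLp hx') 0
    have h21 := congrFun (congrArg WithLp.ofLp hx') 1
    simp only [PiLp.add_apply, PiLp.smul_apply, smul_eq_mul] at h10 h11 h20 h21
    obtain rfl : s = 1 - r - t := by linarith
    obtain rfl : c = 1 - d := by linarith
    set A := (S.tip j 0 - S.tip m 0) * (S.finish m 1 - S.tip m 1) -
        (S.tip j 1 - S.tip m 1) * (S.finish m 0 - S.tip m 0) with hA
    set B := (S.tip k 0 - S.tip m 0) * (S.finish m 1 - S.tip m 1) -
        (S.tip k 1 - S.tip m 1) * (S.finish m 0 - S.tip m 0) with hB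
    -- `A` and `B` measure on which side of the slit the two neighbours lie. Having the same sign,
    -- they force `r = t = 0`, so the slit could meet the triangle only at its own tip.
    have hsum : r * A + t * B = 0 := by
      rw [hA, hB]
      linear_combination -(S.finish m 1 - S.tip m 1) * (h10 + h20) +
        (S.finish m 0 - S.tip m 0) * (h11 + h21)
    have hA0 : A ≠ 0 := left_ne_zero_of_mul hside.ne'
    have hB0 : B ≠ 0 := right_ne_zero_of_mul hside.ne'
    have hr0 : r = 0 := by
      have h1 : r * A ^ 2 + t * (A * B) = 0 := by linear_combination A * hsum
      have h2 : 0 < A ^ 2 := by positivity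
      have h3 : 0 ≤ t * (A * B) := mul_nonneg ht hside.le
      by_contra hne
      have h4 : 0 < r * A ^ 2 := mul_pos (lt_of_le_of_ne hr (Ne.symm hne)) h2
      linarith
    have ht0 : t = 0 := by
      rw [hr0, zero_mul, zero_add] at hsum
      exact (mul_eq_zero.1 hsum).resolve_right hB0
    rw [hr0, ht0] at hx
    refine S.tip_notMem_slit m m ?_
    rwa [show x = S.tip m by rw [hx]; simp] at hxm'

/-- If the edges `ij` and `kl` cross at `p`, then there is a chain from `i` to `k` shorter than the
path over `p`. -/
theorem exists_chain_lt_of_cross [Fintype ι] [DecidableEq ι] {i j k l : ι}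
    (hij : S.visGraph.Adj i j) (hkl : S.visGraph.Adj k l) (hik : i ≠ k) (hil : i ≠ l)
    (hjk : j ≠ k) (hjl : j ≠ l) {p : Plane} (h₁ : p ∈ segment ℝ (S.tip i) (S.tip j))
    (h₂ : p ∈ segment ℝ (S.tip k) (S.tip l)) :
    ∃ r < dist (S.tip i) p + dist p (S.tip k), HasChain S.visGraph S.tipDist i k r := by
  have hp : ∀ m, S.tip m ≠ p := by
    rintro m rfl
    rcases S.eq_or_eq_of_tip_mem hij.ne h₁ with rfl | rfl <;>
      rcases S.eq_or_eq_of_tip_mem hkl.ne h₂ with rfl | rfl <;> contradiction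
  have side : ∀ {i j : ι}, i ≠ j → p ∈ segment ℝ (S.tip i) (S.tip j) →
      ∀ m, S.tip m ∈ segment ℝ (S.tip i) p → m = i := by
    intro i j hij h₁ m hm
    refine (S.eq_or_eq_of_tip_mem hij
      ((convex_segment _ _).segment_subset (left_mem_segment ..) h₁ hm)).resolve_right ?_
    rintro rfl
    exact hp m (wbtw_swap_right_iff ℝ (S.tip i) |>.1
      ⟨mem_segment_iff_wbtw.1 hm, mem_segment_iff_wbtw.1 h₁⟩)
  refine S.exists_chain_lt hik ?_ (hij.2.mono (left_mem_segment ..) h₁)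
    (hkl.2.mono h₂ (left_mem_segment ..)) (fun m hm => Or.inl (side hij.ne h₁ m hm))
    (fun m hm => Or.inr (side hkl.ne h₂ m (by rwa [segment_symm])))
    (fun m hm => absurd hm (hp m)) ?_
  · have h := S.tips i j k hij.ne hik hjk
    rw [not_collinear_iff_det] at h ⊢
    obtain ⟨a, b, -, -, hab, hx⟩ := h₁
    obtain rfl : a = 1 - b := by linarith
    have hb : b ≠ 0 := by
      rintro rfl
      exact hp i (by rw [← hx]; simp)
    intro h0
    apply mul_ne_zero hb h
    rw [← h0, ← hx]
    simp only [PiLp.add_apply, PiLp.smul_apply, smul_eq_mul]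
    ring
  · obtain ⟨a, b, ha, hb, hab, hx⟩ := h₁
    exact S.φ_lt_bound_of_mem_triangle (S.lt_bound i) (S.lt_bound j) (S.lt_bound j)
      ⟨a, b, 0, ha, hb, le_rfl, by linarith, by rw [← hx]; simp⟩

/-- Steps to tips further left can stop only at the leftmost tip, which is the root. -/
theorem exists_chain_root [Fintype ι] [DecidableEq ι] [Nonempty ι] (ψ : Plane →ₗ[ℝ] ℝ)
    (hψ : ∀ x, S.φ x = 0 → ψ x = 0 → x = 0) (hinj : Function.Injective fun i => S.φ (S.tip i)) :
    ∃ r, ∀ i, ∃ c, HasChain S.visGraph S.tipDist i r c := by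
  obtain ⟨r, hr⟩ := Finite.exists_min fun i => S.φ (S.tip i)
  refine ⟨r, ?_⟩
  by_contra hcon
  obtain ⟨i, hi, hmin⟩ := Set.exists_min_image {i | ¬ ∃ c, HasChain S.visGraph S.tipDist i r c}
    (fun i => S.φ (S.tip i)) (Set.toFinite _) (not_forall.1 hcon)
  have hir : i ≠ r := by
    rintro rfl
    exact hi ⟨0, HasChain.refl _⟩
  obtain ⟨q, hq, hadj⟩ := S.exists_adj_lt ψ hψ i
    ⟨r, lt_of_le_of_ne (hr i) fun h => hir (hinj h).symm⟩
  have hq' : ∃ c, HasChain S.visGraph S.tipDist q r c := by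
    by_contra h
    exact absurd (hmin q h) (not_le.2 hq)
  obtain ⟨c, hc⟩ := hq'
  exact hi ⟨_, (HasChain.of_adj hadj).trans S.tipDist_nonneg hc⟩

/-- The tips of an even slit system have a perfect matching by segments that meet no slit and do not
cross. -/
theorem exists_matching [Fintype ι] (ψ : Plane →ₗ[ℝ] ℝ)
    (hψ : ∀ x, S.φ x = 0 → ψ x = 0 → x = 0) (hinj : Function.Injective fun i => S.φ (S.tip i))
    (hcard : Even (Fintype.card ι)) :
    ∃ Γ : SimpleGraph ι, Γ ≤ S.visGraph ∧ (∀ i, ∃! j, Γ.Adj i j) ∧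
      ∀ i j k l, Γ.Adj i j → Γ.Adj k l → i ≠ k → i ≠ l → j ≠ k → j ≠ l →
        Disjoint (segment ℝ (S.tip i) (S.tip j)) (segment ℝ (S.tip k) (S.tip l)) := by
  classical
  rcases isEmpty_or_nonempty ι with hι | hι
  · exact ⟨⊥, bot_le, fun i => hι.elim i, fun i => hι.elim i⟩
  obtain ⟨r, hr⟩ := S.exists_chain_root ψ hψ hinj
  obtain ⟨F, hF, hFb, hmin⟩ := exists_shortest_chain hcard r hr
  have hadj : ∀ {i j}, F s(i, j) ≠ 0 → S.visGraph.Adj i j := fun h => hF _ h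
  refine ⟨⟨fun i j => F s(i, j) ≠ 0, ⟨fun i j h => by rwa [Sym2.eq_swap]⟩,
    ⟨fun i h => (hadj h).ne rfl⟩⟩, fun i j h => hadj h, ?_, ?_⟩
  · intro i
    have hbi : ∑ e, (if i ∈ e then F e else 0) = 1 := by
      have h := congrFun hFb i
      simp only [boundary, Pi.one_apply] at h
      convert h
    obtain ⟨e, -, he⟩ := Finset.exists_ne_zero_of_sum_ne_zero (hbi.symm ▸ one_ne_zero)
    have hie : i ∈ e := by
      by_contra h
      simp [h] at he
    obtain ⟨j, rfl⟩ := Sym2.mem_iff_exists.1 hie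
    rw [if_pos hie] at he
    refine ⟨j, he, fun j' he' => ?_⟩
    by_contra hne
    replace he' : F s(i, j') ≠ 0 := he'
    have hsame : ∀ j k, j ≠ k → F s(i, j) ≠ 0 → F s(i, k) ≠ 0 →
        ¬ 0 < ((S.tip j 0 - S.tip i 0) * (S.finish i 1 - S.tip i 1) -
          (S.tip j 1 - S.tip i 1) * (S.finish i 0 - S.tip i 0)) *
        ((S.tip k 0 - S.tip i 0) * (S.finish i 1 - S.tip i 1) -
          (S.tip k 1 - S.tip i 1) * (S.finish i 0 - S.tip i 0)) := by
      intro j k hjk hj hk hside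
      obtain ⟨c, hc, E, hE, hEb, hEl⟩ :=
        S.exists_chain_lt_of_same_side (hadj hj) (hadj hk) hjk hside
      have h := exchange_le S.tipDist_nonneg hF hFb hmin (e₁ := s(i, j)) (e₂ := s(i, k))
        (fun h => hjk (Sym2.congr_right.1 h)) hj hk hE (by
          rw [boundary_single (hadj hj).ne, boundary_single (hadj hk).ne, hEb]
          funext v
          simp only [Pi.add_apply]
          generalize (Pi.single i 1 : ι → ZMod 2) v = x
          generalize (Pi.single j 1 : ι → ZMod 2) v = y
          generalize (Pi.single k 1 : ι → ZMod 2) v = z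
          revert x y z
          decide)
      have h1 : S.tipDist s(i, j) = dist (S.tip i) (S.tip j) := rfl
      have h2 : S.tipDist s(i, k) = dist (S.tip i) (S.tip k) := rfl
      rw [h1, h2, dist_comm] at h
      linarith
    -- With only the two edges to `j` and `j'`, the degree of `i` would be even.
    have hthird : ∃ k, k ≠ j ∧ k ≠ j' ∧ F s(i, k) ≠ 0 := by
      by_contra hcon
      push Not at hcon
      rw [Finset.sum_eq_add s(i, j) s(i, j') (fun h => hne (Sym2.congr_right.1 h).symm)] at hbi
      · rw [if_pos (Sym2.mem_mk_left ..), if_pos (Sym2.mem_mk_left ..)] at hbi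
        generalize F s(i, j) = x at he hbi
        generalize F s(i, j') = y at he' hbi
        revert he he' hbi
        revert x y
        decide
      · rintro e - ⟨h1, h2⟩
        split_ifs with h
        · obtain ⟨k, rfl⟩ := Sym2.mem_iff_exists.1 h
          exact hcon k (fun h => h1 (by rw [h])) (fun h => h2 (by rw [h]))
        · rfl
      · simp
      · simp
    obtain ⟨k, hkj, hkj', hk⟩ := hthird
    have hdet : ∀ j, F s(i, j) ≠ 0 → (S.tip j 0 - S.tip i 0) * (S.finish i 1 - S.tip i 1) -
          (S.tip j 1 - S.tip i 1) * (S.finish i 0 - S.tip i 0) ≠ 0 := by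
      intro j hj
      have := S.tip_off j i (hadj hj).ne.symm
      rw [Set.insert_comm, not_collinear_iff_det] at this
      exact this
    -- Each of the three edges lies strictly on one of the two sides of the slit, so two of them
    -- share a side.
    have a1 := hsame j j' (Ne.symm hne) he he'
    have a2 := hsame j k hkj.symm he hk
    have a3 := hsame j' k hkj'.symm he' hk
    have b1 := hdet j he
    have b2 := hdet j' he'
    have b3 := hdet k hk
    simp only [mul_pos_iff, not_or, not_and, not_lt] at a1 a2 a3
    rcases lt_or_gt_of_ne b1 with c1 | c1 <;> rcases lt_or_gt_of_ne b2 with c2 | c2 <;>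
      rcases lt_or_gt_of_ne b3 with c3 | c3 <;>
      first
      | exact absurd (a1.1 c1) (not_le.2 c2)
      | exact absurd (a1.2 c1) (not_le.2 c2)
      | exact absurd (a2.1 c1) (not_le.2 c3)
      | exact absurd (a2.2 c1) (not_le.2 c3)
      | exact absurd (a3.1 c2) (not_le.2 c3)
      | exact absurd (a3.2 c2) (not_le.2 c3)
  · intro i j k l hij hkl hik hil hjk hjl
    rw [Set.disjoint_left]
    intro p h₁ h₂
    replace hij : F s(i, j) ≠ 0 := hij
    replace hkl : F s(k, l) ≠ 0 := hkl
    -- One chain joins `i` to `k`, the next `j` to `l`; together they are shorter than the two edges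
    -- crossing at `p`.
    obtain ⟨c, hc, E, hE, hEb, hEl⟩ :=
      S.exists_chain_lt_of_cross (hadj hij) (hadj hkl) hik hil hjk hjl h₁ h₂
    obtain ⟨c', hc', E', hE', hEb', hEl'⟩ :=
      S.exists_chain_lt_of_cross (hadj hij).symm (hadj hkl).symm hjl hjk hil hik
        (by rwa [segment_symm]) (by rwa [segment_symm])
    have h := exchange_le S.tipDist_nonneg hF hFb hmin (e₁ := s(i, j)) (e₂ := s(k, l))
      (by rw [Ne, Sym2.eq_iff]; tauto) hij hkl (support_add hE hE') (by
        rw [boundary_single (hadj hij).ne, boundary_single (hadj hkl).ne, boundary_add, hEb, hEb']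
        abel)
    have h1 := chainLength_add_le S.tipDist_nonneg E E'
    have d1 : S.tipDist s(i, j) = dist (S.tip i) (S.tip j) := rfl
    have d2 : S.tipDist s(k, l) = dist (S.tip k) (S.tip l) := rfl
    have d3 := dist_add_dist_of_mem_segment h₁
    have d4 := dist_add_dist_of_mem_segment h₂
    rw [dist_comm (S.tip j) p, dist_comm p (S.tip l)] at hc'
    rw [dist_comm p (S.tip k)] at hc
    rw [dist_comm (S.tip l) p] at hc'
    linarith

end SlitSystem

/-! ### Matching left and right endpoints -/

/-- Take `x 0 + c * x 1`, where `c` avoids the finitely many values at which two points of `V` with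
different second coordinates could agree; `ψ` is the second coordinate. -/
theorem exists_linear_injOn (V : Finset Plane) :
    ∃ φ ψ : Plane →ₗ[ℝ] ℝ, (∀ x, φ x = 0 → ψ x = 0 → x = 0) ∧
      ∀ v w : V, φ v = φ w → v = w := by
  obtain ⟨c, hc⟩ := (Set.finite_range fun p : V × V =>
    ((p.2 : Plane) 0 - (p.1 : Plane) 0) / ((p.1 : Plane) 1 - (p.2 : Plane) 1)).exists_notMem
  refine ⟨⟨⟨fun x => x 0 + c * x 1, fun x y => by simp; ring⟩, fun r x => by simp; ring⟩,
    ⟨⟨fun x => x 1, fun x y => by simp⟩, fun r x => by simp⟩, ?_, ?_⟩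
  · intro x h0 h1
    replace h0 : x 0 + c * x 1 = 0 := h0
    replace h1 : x 1 = 0 := h1
    rw [h1, mul_zero, add_zero] at h0
    ext i
    fin_cases i
    · simpa using h0
    · simpa using h1
  · intro v w h
    replace h : (v : Plane) 0 + c * (v : Plane) 1 = (w : Plane) 0 + c * (w : Plane) 1 := h
    have h1 : (v : Plane) 1 = (w : Plane) 1 := by
      by_contra hne
      refine hc ⟨(v, w), ?_⟩
      have := sub_ne_zero.2 hne
      beta_reduce
      rw [div_eq_iff this]
      linarith
    apply Subtype.ext
    ext i
    fin_cases i
    · rw [h1] at h; simpa using h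
    · simpa using h1

/-- The left endpoints (with respect to `φ`) of an even perfect matching have a non-crossing perfect
matching in the visibility graph that uses no edge of the given matching. -/
theorem exists_matching_left {V : Finset Plane} (hV : GeneralPosition V) {M : SimpleGraph V}
    (hM : NonCrossing M) (hEven : Even M.edgeSet.ncard) {π : V → V}
    (hπ : ∀ v w, M.Adj v w ↔ w = π v) (φ ψ : Plane →ₗ[ℝ] ℝ)
    (hψ : ∀ x, φ x = 0 → ψ x = 0 → x = 0) (hφ : ∀ v w : V, φ v = φ w → v = w) :
    ∃ N : SimpleGraph V, N ≤ visibilityGraph M \ M ∧ NonCrossing N ∧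
      (∀ v w, N.Adj v w → φ v < φ (π v)) ∧ ∀ v : V, φ v < φ (π v) → ∃! w, N.Adj v w := by
  classical
  have adj : ∀ v, M.Adj v (π v) := fun v => (hπ v _).2 rfl
  have invol : ∀ v, π (π v) = v := fun v => ((hπ _ _).1 (adj v).symm).symm
  let ι := {v : V // φ v < φ (π v)}
  have ne_π : ∀ i k : ι, i.1 ≠ π k.1 := by
    intro i k h
    have h1 := i.2
    have h2 := k.2
    rw [h, invol] at h1
    exact lt_asymm h1 h2
  have val_ne : ∀ {i k : ι}, i ≠ k → i.1 ≠ k.1 := fun h h' => h (Subtype.ext h')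
  have gp : ∀ u v w : V, u ≠ v → u ≠ w → v ≠ w → ¬ Collinear ℝ {(u : Plane), (v : Plane), (w : Plane)} :=
    fun u v w h1 h2 h3 => hV u u.2 v v.2 w w.2 (fun h => h1 (Subtype.ext h))
      (fun h => h2 (Subtype.ext h)) (fun h => h3 (Subtype.ext h))
  obtain ⟨S, hS, hSφ, hSlit⟩ := exists_slitSystem (ι := ι) (fun i => (i.1 : Plane))
    (fun i => (π i.1 : Plane)) φ (fun i => i.2)
    (fun i j k h1 h2 h3 => gp _ _ _ (val_ne h1) (val_ne h2) (val_ne h3))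
    (fun i k h => gp _ _ _ (val_ne h) (ne_π i k) (ne_π k k))
    (by
      intro i k hik
      rw [Set.disjoint_left]
      intro p h1 h2
      refine hM i.1 (π i.1) k.1 (π k.1) (adj _) (adj _) ?_
        ⟨p, ⟨openSegment_subset_segment _ _ _ h1, openSegment_subset_segment _ _ _ h2⟩, ?_⟩
      · rw [Ne, Sym2.eq_iff]
        rintro (⟨h, -⟩ | ⟨h, -⟩)
        exacts [val_ne hik h, ne_π i k h]
      · rintro ⟨h3 | h3, h4 | h4⟩
        · exact val_ne hik (Subtype.ext (h3.symm.trans h4))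
        · exact ne_π i k (Subtype.ext (h3.symm.trans h4))
        · exact ne_π k i (Subtype.ext (h4.symm.trans h3))
        · have h5 : π i.1 = π k.1 := Subtype.ext (h3.symm.trans h4)
          exact val_ne hik (by rw [← invol i.1, h5, invol]))
  -- Each edge of `M` has exactly one left endpoint.
  have hcard : Even (Fintype.card ι) := by
    have hrange : M.edgeSet = Set.range fun i : ι => s(i.1, π i.1) := by
      ext e
      induction e with
      | _ v w =>
      rw [SimpleGraph.mem_edgeSet, hπ]
      constructor
      · rintro rfl
        rcases lt_trichotomy (φ v) (φ (π v)) with h | h | h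
        · exact ⟨⟨v, h⟩, rfl⟩
        · exact absurd (hφ _ _ h) (adj v).ne
        · exact ⟨⟨π v, by rwa [invol]⟩, by simp only [invol]; exact Sym2.eq_swap⟩
      · rintro ⟨i, hi⟩
        rw [Sym2.eq_iff] at hi
        rcases hi with ⟨h1, h2⟩ | ⟨h1, h2⟩
        · rw [← h1, h2]
        · rw [← h2, invol, h1]
    have hinj : Function.Injective fun i : ι => s(i.1, π i.1) := by
      intro i k h
      by_contra hik
      rcases Sym2.eq_iff.1 h with ⟨h1, -⟩ | ⟨h1, -⟩
      exacts [val_ne hik h1, ne_π i k h1]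
    rw [hrange, ← Set.image_univ, Set.ncard_image_of_injective _ hinj, Set.ncard_univ,
      Nat.card_eq_fintype_card] at hEven
    exact hEven
  obtain ⟨Γ, hΓ, huniq, hdisj⟩ := S.exists_matching ψ (by rwa [hSφ])
    (fun i k h => Subtype.ext (hφ _ _ (by simpa only [hS, hSφ] using h))) hcard
  have tip_eq : ∀ i, S.tip i = (i.1 : Plane) := fun i => congrFun hS i
  -- Slits are open, so freeness only controls the interior of an edge. General position excludes
  -- its right endpoint, and allows its tip only as an end of the segment.
  have meets : ∀ {i j : ι}, Γ.Adj i j → ∀ (k : ι) (p : Plane),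
      p ∈ segment ℝ (S.tip i) (S.tip j) → p ∈ segment ℝ (S.tip k) (π k.1 : Plane) →
      p = S.tip k ∧ (k = i ∨ k = j) := by
    intro i j hij k p h1 h2
    have hadj := hΓ hij
    by_cases hp : p = S.tip k
    · exact ⟨hp, S.eq_or_eq_of_tip_mem hadj.1 (hp ▸ h1)⟩
    by_cases hp' : p = π k.1
    · subst hp'
      refine absurd (mem_segment_iff_wbtw.1 h1).collinear ?_
      rw [tip_eq, tip_eq]
      exact gp _ _ _ (ne_π i k) (val_ne hadj.1) (ne_π j k).symm
    · refine absurd ?_ (Set.disjoint_left.1 (hadj.2 k) h1)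
      apply hSlit k
      have := mem_openSegment_of_ne_left_right (Ne.symm hp) (Ne.symm hp') h2
      rwa [tip_eq] at this
  refine ⟨Γ.map Subtype.val, ?_, ?_, ?_, ?_⟩
  · rintro _ _ ⟨-, i, j, hij, rfl, rfl⟩
    have hne := (hΓ hij).1
    refine ⟨⟨val_ne hne, ?_⟩, fun h => ne_π j i ((hπ _ _).1 h)⟩
    have key : ∀ k : ι, ∀ p, p ∈ segment ℝ (i.1 : Plane) (j.1 : Plane) →
        p ∈ segment ℝ (k.1 : Plane) (π k.1 : Plane) →
        p = k.1 ∧ p ∈ ({(i.1 : Plane), (j.1 : Plane)} : Set Plane) := by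
      intro k p h1 h2
      rw [← tip_eq, ← tip_eq] at h1
      rw [← tip_eq] at h2
      obtain ⟨h3, h4⟩ := meets hij k p h1 h2
      rw [tip_eq] at h3
      refine ⟨h3, ?_⟩
      rcases h4 with rfl | rfl
      · exact Or.inl h3
      · exact Or.inr h3
    rintro c d hcd - ⟨p, ⟨h1, h2⟩, h3⟩
    obtain rfl := (hπ _ _).1 hcd
    rcases lt_trichotomy (φ c) (φ (π c)) with h | h | h
    · obtain ⟨h4, h5⟩ := key ⟨c, h⟩ p h1 h2
      exact h3 ⟨h5, Or.inl h4⟩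
    · exact absurd (hφ _ _ h) hcd.ne
    · obtain ⟨h4, h5⟩ := key ⟨π c, by rwa [invol]⟩ p h1 (by
        simp only [invol]; rwa [segment_symm])
      exact h3 ⟨h5, Or.inr h4⟩
  · rintro _ _ _ _ ⟨-, i, j, hij, rfl, rfl⟩ ⟨-, k, l, hkl, rfl, rfl⟩ hne ⟨p, ⟨h1, h2⟩, -⟩
    rw [← tip_eq, ← tip_eq] at h1 h2
    refine Set.disjoint_left.1 (hdisj i j k l hij hkl ?_ ?_ ?_ ?_) h1 h2 <;> rintro rfl
    · exact hne (by rw [(huniq i).unique hij hkl])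
    · exact hne (by rw [(huniq i).unique hij hkl.symm, Sym2.eq_swap])
    · exact hne (by rw [(huniq j).unique hij.symm hkl, Sym2.eq_swap])
    · exact hne (by rw [(huniq j).unique hij.symm hkl.symm])
  · rintro _ _ ⟨-, i, j, hij, rfl, rfl⟩
    exact i.2
  · intro v hv
    obtain ⟨j, hj, hj'⟩ := huniq ⟨v, hv⟩
    refine ⟨j.1, ⟨val_ne (hΓ hj).1, ⟨v, hv⟩, j, hj, rfl, rfl⟩, ?_⟩
    rintro _ ⟨-, i, k, hik, rfl, rfl⟩
    exact congrArg Subtype.val (hj' k hik)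

end GeomGraph

theorem mainTheorem8 (V : Finset GeomGraph.Plane) (hV : GeomGraph.GeneralPosition V)
    (M : SimpleGraph V) (hM : GeomGraph.IsPerfectMatching M) (hEven : Even M.edgeSet.ncard) :
    ∃ N : (GeomGraph.visibilityGraph M \ M).Subgraph, N.IsPerfectMatching ∧
      ∃ M₁ M₂ : SimpleGraph V, GeomGraph.IsMatching M₁ ∧ GeomGraph.IsMatching M₂ ∧
        N.spanningCoe = M₁ ⊔ M₂ := by
  obtain ⟨φ, ψ, hψ, hφ⟩ := GeomGraph.exists_linear_injOn V
  obtain ⟨hM, hM'⟩ := hM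
  choose π hπ₁ hπ₂ using hM'
  have hπ : ∀ v w, M.Adj v w ↔ w = π v := fun v w => ⟨hπ₂ v w, fun h => h ▸ hπ₁ v⟩
  obtain ⟨M₁, hle₁, hnc₁, hl₁, hu₁⟩ :=
    GeomGraph.exists_matching_left hV hM hEven hπ φ ψ hψ hφ
  -- Reversing `φ` turns right endpoints into left ones.
  obtain ⟨M₂, hle₂, hnc₂, hl₂, hu₂⟩ :=
    GeomGraph.exists_matching_left hV hM hEven hπ (-φ) ψ (fun x h => hψ x (by simpa using h))
      (fun v w h => hφ v w (by simpa using h))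
  simp only [LinearMap.neg_apply, neg_lt_neg_iff] at hl₂ hu₂
  refine ⟨SimpleGraph.toSubgraph (M₁ ⊔ M₂) (sup_le hle₁ hle₂), ⟨?_, fun v => trivial⟩, M₁, M₂,
    ⟨hnc₁, ?_⟩, ⟨hnc₂, ?_⟩, rfl⟩
  · intro v _
    rcases lt_trichotomy (φ v) (φ (π v)) with h | h | h
    · obtain ⟨w, hw, hw'⟩ := hu₁ v h
      exact ⟨w, Or.inl hw, fun y hy => hy.elim (hw' y) fun hy => absurd (hl₂ _ _ hy) h.asymm⟩
    · exact absurd (hφ _ _ h) (hπ₁ v).ne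
    · obtain ⟨w, hw, hw'⟩ := hu₂ v h
      exact ⟨w, Or.inr hw, fun y hy => hy.elim (fun hy => absurd (hl₁ _ _ hy) h.asymm) (hw' y)⟩
  · intro v w hw w' hw'
    exact (hu₁ v (hl₁ _ _ hw)).unique hw hw'
  · intro v w hw w' hw'
    exact (hu₂ v (hl₂ _ _ hw)).unique hw hw'
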